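/- **Setting.** Fix $a>0$, $b\neq 0$ with $a+b\neq 0$, $\mu>0$ and $0<I_1<I_2<I_3$. A ball of radius $|b|$, mass $\mu$, with center of mass at its geometric center and principal central moments of inertia $I_1,I_2,I_3$ (put $A=\mathrm{diag}(I_1,I_2,I_3)$), rolls without slipping and without twisting on the fixed sphere $S_a$ of radius $a$ centered at the origin; $b>0$ means that it rolls outside $S_a$, $b<0$ that one of the two spheres contains the other. A configuration is $(q,R)\in S_a\times SO(3)$, where $q$ is the contact point and $R$ the attitude matrix; the center of mass is $(1+\frac ba)q$, and the angular velocity is $\omega$ in space, $\Omega=R^{-1}\omega$ in the body. The kinetic energy is $2T=\mu(1+\frac ba)^2|\dot q|^2+(A\Omega,\Omega)$, the constraints are $(1+\frac ba)\dot q=\frac ba\,\omega\times q$ and $\omega\cdot q=0$, and the motions are the $C^2$ curves that satisfy the constraints and d'Alembert's principle. Let $\gamma=R^{-1}q/a\in S^2$ be the Poisson vector. On each open octant of $S^2$ (all $\gamma_j\neq 0$, with prescribed signs) sphero-conical coordinates $I_1<\lambda_1<I_2<\lambda_2<I_3$ are given by $$\gamma_1^2=\tfrac{(I_1-\lambda_1)(I_1-\lambda_2)}{(I_1-I_3)(I_1-I_2)},\quad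 \gamma_2^2=\tfrac{(I_2-\lambda_1)(I_2-\lambda_2)}{(I_2-I_3)(I_2-I_1)},\quad \gamma_3^2=\tfrac{(I_3-\lambda_1)(I_3-\lambda_2)}{(I_3-I_1)(I_3-I_2)}.$$ Let $T_{red}(\gamma,\dot\gamma)=\frac12(1+\frac ba)^2\left[\mu b^2|\dot\gamma|^2+(A(\gamma\times\dot\gamma),\gamma\times\dot\gamma)\right]$ be the kinetic energy of the horizontal lift of $\dot\gamma$, let $p_i=\partial T_{red}/\partial\dot\lambda_i$, and use $$P_i=\left|1+\tfrac ba\right|^{\frac{a-b}{a}}\left[(\lambda_1+\mu b^2)(\lambda_2+\mu b^2)\right]^{\frac{b-a}{2a}}p_i .$$ Put $$F(\gamma)=I_1I_2I_3\left(1+\tfrac ba\right)^2\left((A^{-1}\gamma,\gamma)+\mu b^2\left[\tfrac{\gamma_2^2+\gamma_3^2}{I_2I_3}+\tfrac{\gamma_1^2+\gamma_3^2}{I_1I_3}+\tfrac{\gamma_1^2+\gamma_2^2}{I_1I_2}\right]+\tfrac{\mu^2b^4}{I_1I_2I_3}\right).$$ **Theorem.** The functions $(\lambda_1,\lambda_2)$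 are coordinates on each open octant (a bijection onto $I_1<\lambda_1<I_2<\lambda_2<I_3$), for each $\lambda$ the map $\dot\gamma\mapsto(P_1,P_2)$ is a bijection from $T_\gamma S^2$ onto $\mathbb R^2$, and $$F(\gamma)=\left(1+\tfrac ba\right)^2(\lambda_1+\mu b^2)(\lambda_2+\mu b^2).$$ Let $$2H=\frac{P_1^2}{[(\lambda_1+\mu b^2)(\lambda_2+\mu b^2)]^{\frac{b-a}{a}}c_1}+\frac{P_2^2}{[(\lambda_1+\mu b^2)(\lambda_2+\mu b^2)]^{\frac{b-a}{a}}c_2},$$ $$c_1=\tfrac14\left(1+\tfrac ba\right)^2(\lambda_2-\lambda_1)\frac{\lambda_2+\mu b^2}{(\lambda_1-I_1)(I_2-\lambda_1)(I_3-\lambda_1)},\qquad c_2=\tfrac14\left(1+\tfrac ba\right)^2(\lambda_2-\lambda_1)\frac{\lambda_1+\mu b^2}{(\lambda_2-I_1)(\lambda_2-I_2)(I_3-\lambda_2)},$$ and let $X_H=(H_P,-H_\lambda)$. The motions project to the reduced phase space of pairs $(\gamma,\dot\gamma)$ as the integral curves of a vector field $X_{nh}$ (every projected motion is an integral curve of $X_{nh}$,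 and from every reduced state and every attitude there starts a motion), which in the coordinates $(\lambda,P)$ is $$X_{nh}=F(\gamma)^{\frac{b-a}{2a}}\,X_H .$$ Consequently, along every motion whose Poisson vector stays in an open octant, and in a new time $\tau$ with $d\tau/dt=F(\gamma)^{\frac{b-a}{2a}}$ (which exists), $(\lambda,P)$ satisfies Hamilton's equations $\frac{d\lambda}{d\tau}=H_P$, $\frac{dP}{d\tau}=-H_\lambda$. -/

import Mathlib

open scoped Matrix

/-- A balanced, dynamically asymmetric ball on a fixed sphere: `a` is the radius of the fixed
sphere, `|b|` the radius of the ball (`b > 0` when the ball rolls outside the fixed sphere, `b < 0`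
when one of the two spheres contains the other), `μ` the mass of the ball and `inertia` its three
principal moments of inertia about its centre, in increasing order. -/
structure RubberBall where
  a : ℝ
  b : ℝ
  μ : ℝ
  inertia : Fin 3 → ℝ
  a_pos : 0 < a
  b_ne : b ≠ 0
  add_ne : a + b ≠ 0
  mu_pos : 0 < μ
  inertia_pos : 0 < inertia 0
  inertia_lt₁ : inertia 0 < inertia 1
  inertia_lt₂ : inertia 1 < inertia 2

namespace RubberBall

/-! ### The nonholonomic system on `S²(a) × SO(3)` -/

/-- The time derivative of a curve of matrices, entry by entry. -/
noncomputable def matrixDeriv (R : ℝ → Matrix (Fin 3) (Fin 3) ℝ) (t : ℝ) :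
    Matrix (Fin 3) (Fin 3) ℝ :=
  Matrix.of fun i j => deriv (fun s => R s i j) t

/-- The angular velocity `ω` in the space frame: the vector that corresponds to the skew-symmetric
matrix `R' Rᵀ`. -/
noncomputable def angularVelocity (R : ℝ → Matrix (Fin 3) (Fin 3) ℝ) (t : ℝ) : Fin 3 → ℝ :=
  ![(matrixDeriv R t * (R t)ᵀ) 2 1, (matrixDeriv R t * (R t)ᵀ) 0 2,
    (matrixDeriv R t * (R t)ᵀ) 1 0]

/-- The inertia operator `A = diag (I₁, I₂, I₃)` in the body frame. -/
noncomputable def inertiaMatrix (B : RubberBall) : Matrix (Fin 3) (Fin 3) ℝ :=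
  Matrix.diagonal B.inertia

/-- The angular momentum `ℓ = R A Ω`, `Ω = Rᵀ ω`, about the centre of mass, in the space frame. -/
noncomputable def angularMomentum (B : RubberBall) (R : ℝ → Matrix (Fin 3) (Fin 3) ℝ) (t : ℝ) :
    Fin 3 → ℝ :=
  R t *ᵥ (B.inertiaMatrix *ᵥ ((R t)ᵀ *ᵥ angularVelocity R t))

/-- The centre of mass `x = (1 + b/a) q` of the ball that touches the fixed sphere at `q`. -/
noncomputable def center (B : RubberBall) (q : Fin 3 → ℝ) : Fin 3 → ℝ :=
  (1 + B.b / B.a) • q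

/-- The rubber constraints on a velocity (or virtual displacement) `(v, ω)` at the contact point
`q`, with `v` the velocity of `q` and `ω` the angular velocity in space: no slip and no twist. -/
def Admissible (B : RubberBall) (q v ω : Fin 3 → ℝ) : Prop :=
  (1 + B.b / B.a) • v = (B.b / B.a) • (ω ⨯₃ q) ∧ ω ⬝ᵥ q = 0

/-- `(q, R)` is a motion of the rubber ball on the time set `J`: `q` is the contact point in the
fixed sphere, `R` the attitude matrix; the velocities satisfy the constraints, and d'Alembert's
principle holds, that is, the rates of change of the linear momentum and of the angular momentum
about the centre of mass do no work on any virtual displacement allowed by the constraints. -/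
structure IsRollingMotion (B : RubberBall) (q : ℝ → Fin 3 → ℝ)
    (R : ℝ → Matrix (Fin 3) (Fin 3) ℝ) (J : Set ℝ) : Prop where
  contDiffOn_q : ContDiffOn ℝ 2 q J
  contDiffOn_R : ∀ i j, ContDiffOn ℝ 2 (fun t => R t i j) J
  mem_sphere : ∀ t ∈ J, q t ⬝ᵥ q t = B.a ^ 2
  mem_rotations : ∀ t ∈ J, R t ∈ Matrix.specialOrthogonalGroup (Fin 3) ℝ
  constraints : ∀ t ∈ J, B.Admissible (q t) (deriv q t) (angularVelocity R t)
  dAlembert : ∀ t ∈ J, ∀ δq δθ : Fin 3 → ℝ, B.Admissible (q t) δq δθ →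
    B.μ * (deriv (deriv fun s => B.center (q s)) t ⬝ᵥ B.center δq)
      + deriv (B.angularMomentum R) t ⬝ᵥ δθ = 0

/-- The Poisson vector `γ = R⁻¹ (q / a)`, for `R` a rotation. -/
noncomputable def poisson (B : RubberBall) (q : ℝ → Fin 3 → ℝ)
    (R : ℝ → Matrix (Fin 3) (Fin 3) ℝ) (t : ℝ) : Fin 3 → ℝ :=
  (R t)ᵀ *ᵥ (B.a⁻¹ • q t)

/-! ### Sphero-conical coordinates on the sphere of Poisson vectors -/

/-- The range `I₁ < λ₁ < I₂ < λ₂ < I₃` of the sphero-conical coordinates. -/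
def coordDomain (B : RubberBall) : Set (Fin 2 → ℝ) :=
  {l | B.inertia 0 < l 0 ∧ l 0 < B.inertia 1 ∧ B.inertia 1 < l 1 ∧ l 1 < B.inertia 2}

/-- The squares of the components of `γ` in sphero-conical coordinates. -/
noncomputable def gammaSq (B : RubberBall) (l : Fin 2 → ℝ) : Fin 3 → ℝ :=
  ![(B.inertia 0 - l 0) * (B.inertia 0 - l 1) /
      ((B.inertia 0 - B.inertia 2) * (B.inertia 0 - B.inertia 1)),
    (B.inertia 1 - l 0) * (B.inertia 1 - l 1) /
      ((B.inertia 1 - B.inertia 2) * (B.inertia 1 - B.inertia 0)),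
    (B.inertia 2 - l 0) * (B.inertia 2 - l 1) /
      ((B.inertia 2 - B.inertia 0) * (B.inertia 2 - B.inertia 1))]

/-- The point `γ` with sphero-conical coordinates `l` in the octant with signs `ε`. -/
noncomputable def gammaOf (B : RubberBall) (ε : Fin 3 → ℝ) (l : Fin 2 → ℝ) : Fin 3 → ℝ :=
  fun j => ε j * Real.sqrt (B.gammaSq l j)

/-- The open octant of the unit sphere with signs `ε`. -/
def octant (ε : Fin 3 → ℝ) : Set (Fin 3 → ℝ) :=
  {g | g ⬝ᵥ g = 1 ∧ ∀ j, 0 < ε j * g j}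

/-- The coordinate vector `∂γ/∂λᵢ`. -/
noncomputable def coordVector (B : RubberBall) (ε : Fin 3 → ℝ) (l : Fin 2 → ℝ) (i : Fin 2) :
    Fin 3 → ℝ :=
  deriv (fun x => B.gammaOf ε (Function.update l i x)) (l i)

/-! ### The reduced phase space and its coordinates -/

/-- Points `(λ, P)`. -/
abbrev Phase : Type := (Fin 2 → ℝ) × (Fin 2 → ℝ)

/-- The kinetic energy `T` of the ball, `2 T = μ (1 + b/a)² |q'|² + (A Ω, Ω)`. -/
noncomputable def kineticEnergy (B : RubberBall) (v Ω : Fin 3 → ℝ) : ℝ :=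
  (B.μ * (1 + B.b / B.a) ^ 2 * (v ⬝ᵥ v) + (B.inertiaMatrix *ᵥ Ω) ⬝ᵥ Ω) / 2

/-- The compressed Lagrangian: the kinetic energy of the horizontal lift
`(q', Ω) = (-b γ', (1 + b/a) γ' × γ)`, at `(aγ, 1)`, of the velocity `γ' = v`. -/
noncomputable def compressedLagrangian (B : RubberBall) (g v : Fin 3 → ℝ) : ℝ :=
  B.kineticEnergy (-B.b • v) ((1 + B.b / B.a) • (v ⨯₃ g))

/-- The momentum `pᵢ` conjugate to `λᵢ`: the fibre derivative at `v` of the compressed Lagrangian,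
applied to `∂γ/∂λᵢ`. -/
noncomputable def conjugateMomentum (B : RubberBall) (ε : Fin 3 → ℝ) (l : Fin 2 → ℝ)
    (v : Fin 3 → ℝ) (i : Fin 2) : ℝ :=
  deriv (fun s : ℝ => B.compressedLagrangian (B.gammaOf ε l) (v + s • B.coordVector ε l i)) 0

/-- The product `(λ₁ + μ b²) (λ₂ + μ b²)`. -/
noncomputable def prodShift (B : RubberBall) (l : Fin 2 → ℝ) : ℝ :=
  (l 0 + B.μ * B.b ^ 2) * (l 1 + B.μ * B.b ^ 2)

/-- The exponent `(b - a) / (2 a)`. -/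
noncomputable def expo (B : RubberBall) : ℝ :=
  (B.b - B.a) / (2 * B.a)

/-- The rescaled momenta
`Pᵢ = |1 + b/a| ^ ((a - b)/a) * [(λ₁ + μ b²) (λ₂ + μ b²)] ^ ((b - a)/(2a)) * pᵢ`. -/
noncomputable def momenta (B : RubberBall) (ε : Fin 3 → ℝ) (l : Fin 2 → ℝ) (v : Fin 3 → ℝ) :
    Fin 2 → ℝ :=
  fun i => |1 + B.b / B.a| ^ ((B.a - B.b) / B.a) * B.prodShift l ^ B.expo *
    B.conjugateMomentum ε l v i

/-- The function `F` on the sphere of Poisson vectors. -/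
noncomputable def F (B : RubberBall) (g : Fin 3 → ℝ) : ℝ :=
  (B.inertia 0 * B.inertia 1 * B.inertia 2) * (1 + B.b / B.a) ^ 2 *
    ((g 0 ^ 2 / B.inertia 0 + g 1 ^ 2 / B.inertia 1 + g 2 ^ 2 / B.inertia 2)
      + B.μ * B.b ^ 2 *
        ((g 1 ^ 2 + g 2 ^ 2) / (B.inertia 1 * B.inertia 2)
          + (g 0 ^ 2 + g 2 ^ 2) / (B.inertia 0 * B.inertia 2)
          + (g 0 ^ 2 + g 1 ^ 2) / (B.inertia 0 * B.inertia 1))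
      + B.μ ^ 2 * B.b ^ 4 / (B.inertia 0 * B.inertia 1 * B.inertia 2))

/-- `(q, R)` is a motion on `J` whose Poisson vector stays in the octant with signs `ε`, and
`z = (λ, P)` is its projection to the reduced phase space, in coordinates. -/
def IsReducedMotion (B : RubberBall) (ε : Fin 3 → ℝ) (q : ℝ → Fin 3 → ℝ)
    (R : ℝ → Matrix (Fin 3) (Fin 3) ℝ) (z : ℝ → Phase) (J : Set ℝ) : Prop :=
  B.IsRollingMotion q R J ∧ ∀ t ∈ J, (z t).1 ∈ B.coordDomain ∧
    B.gammaOf ε (z t).1 = B.poisson q R t ∧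
    (z t).2 = B.momenta ε (z t).1 (deriv (B.poisson q R) t)

/-- `X` is the reduced nonholonomic vector field `X_nh` in the coordinates `(λ, P)`: the projection
of every motion is an integral curve of `X`, and for every reduced state and every attitude there is
a motion that starts there. -/
def IsNonholonomicField (B : RubberBall) (ε : Fin 3 → ℝ) (X : Phase → Phase) : Prop :=
  (∀ (J : Set ℝ) (q : ℝ → Fin 3 → ℝ) (R : ℝ → Matrix (Fin 3) (Fin 3) ℝ) (z : ℝ → Phase),
      IsOpen J → J.OrdConnected → B.IsReducedMotion ε q R z J →
      ∀ t ∈ J, HasDerivAt z (X (z t)) t) ∧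
  (∀ (z₀ : Phase) (R₀ : Matrix (Fin 3) (Fin 3) ℝ), z₀.1 ∈ B.coordDomain →
      R₀ ∈ Matrix.specialOrthogonalGroup (Fin 3) ℝ →
      ∃ (δ : ℝ) (q : ℝ → Fin 3 → ℝ) (R : ℝ → Matrix (Fin 3) (Fin 3) ℝ) (z : ℝ → Phase), 0 < δ ∧
        B.IsReducedMotion ε q R z (Set.Ioo (-δ) δ) ∧ z 0 = z₀ ∧ R 0 = R₀)

/-! ### The Hamiltonian system -/

/-- The canonical Hamiltonian vector field `(∂H/∂P, -∂H/∂λ)` of a function `H (λ, P)`. -/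
noncomputable def canonicalField (H : Phase → ℝ) (z : Phase) : Phase :=
  (fun i => deriv (fun x => H (z.1, Function.update z.2 i x)) (z.2 i),
    fun i => -deriv (fun x => H (Function.update z.1 i x, z.2)) (z.1 i))

/-- The coefficient `c₁`. -/
noncomputable def c₁ (B : RubberBall) (l : Fin 2 → ℝ) : ℝ :=
  1 / 4 * (1 + B.b / B.a) ^ 2 * (l 1 - l 0) * ((l 1 + B.μ * B.b ^ 2) /
    ((l 0 - B.inertia 0) * (B.inertia 1 - l 0) * (B.inertia 2 - l 0)))

/-- The coefficient `c₂`. -/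
noncomputable def c₂ (B : RubberBall) (l : Fin 2 → ℝ) : ℝ :=
  1 / 4 * (1 + B.b / B.a) ^ 2 * (l 1 - l 0) * ((l 0 + B.μ * B.b ^ 2) /
    ((l 1 - B.inertia 0) * (l 1 - B.inertia 1) * (B.inertia 2 - l 1)))

/-- The Hamiltonian `H (λ, P)`. -/
noncomputable def hamiltonian (B : RubberBall) (z : Phase) : ℝ :=
  (z.2 0 ^ 2 / (B.prodShift z.1 ^ ((B.b - B.a) / B.a) * B.c₁ z.1)
    + z.2 1 ^ 2 / (B.prodShift z.1 ^ ((B.b - B.a) / B.a) * B.c₂ z.1)) / 2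

end RubberBall

/-!
The proof reduces the motion to the Poisson vector `γ` and then writes the reduced equation in
sphero-conical coordinates. Put `k = 1 + b/a` and `J = A + μ b²`.

*Reduction.* The constraints say that `(q', Ω)` is the horizontal lift of `γ'`, that is
`Ω = k γ' × γ` and `q' = -b R γ'` (`IsRollingMotion.horizontal`). Testing d'Alembert's principle on
the virtual rotations orthogonal to `γ` shows that `J Ω' + Ω × A Ω` is parallel to `γ`
(`IsRollingMotion.body_equation`).

*Geometry of the coordinates.* The vectors `∂γ/∂λᵢ = γ / (2 (λᵢ - A))` (componentwise) are
orthogonal to each other and to `γ`, and their lifts `nᵢ = ∂γ/∂λᵢ × γ` satisfy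
`k² (J nᵢ, nⱼ) = δᵢⱼ cᵢ` (`contactForm_lift_self`, `contactForm_lift_zero_one`). Hence
`pᵢ = k² (J (γ' × γ), nᵢ) = cᵢ λᵢ'`, which gives the bijectivity of the momenta and the first half
of Hamilton's equations.

*Dynamics.* Differentiating `pᵢ = k² (J (γ' × γ), nᵢ)` and using the body equation, the derivatives
of the orthogonality relations and `∂₂n₁ - ∂₁n₂ = 2 ∂₁γ × ∂₂γ`, one finds
`pᵢ' = ∂L/∂λᵢ + ` a gyroscopic force quadratic in the velocities, with coefficients
`σ (A nⱼ, γ)`, `σ = det (∂₁γ, ∂₂γ, γ)`. In sphero-conical coordinates `2 k² σ (A nⱼ, γ)` equals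
`c₁ / (λ₂ + μ b²)` and `-c₂ / (λ₁ + μ b²)`, so that the force is exactly the one produced by the
rescaling of momenta and time with the multiplier `F ^ ((b - a)/(2a))` (`momentum_rate`,
`IsReducedMotion.hasDerivAt`).

*Existence.* The body equations with the multiplier that preserves `Ω ⟂ γ` form a `C¹` vector field
on the states `(R, γ, Ω)`; by Picard-Lindelöf it has integral curves, its first integrals keep `R` a
rotation and `γ` a unit vector, and the curves are motions of the ball
(`exists_isReducedMotion`). The uniqueness of derivatives then determines the vector field.
-/

namespace RubberBall

variable (B : RubberBall)

/-! ### Sphero-conical coordinates -/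

theorem coordDomain_ne {l : Fin 2 → ℝ} (hl : l ∈ B.coordDomain) (i : Fin 2) (j : Fin 3) :
    l i - B.inertia j ≠ 0 := by
  obtain ⟨h1, h2, h3, h4⟩ := hl
  apply sub_ne_zero.2
  fin_cases i <;> fin_cases j <;> dsimp
  exacts [h1.ne', h2.ne, (h2.trans B.inertia_lt₂).ne, (B.inertia_lt₁.trans h3).ne', h3.ne', h4.ne]

theorem gammaSq_pos {l : Fin 2 → ℝ} (hl : l ∈ B.coordDomain) (j : Fin 3) : 0 < B.gammaSq l j := by
  obtain ⟨h1, h2, h3, h4⟩ := hl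
  have h5 := B.inertia_lt₁
  have h6 := B.inertia_lt₂
  fin_cases j <;> simp only [gammaSq] <;> dsimp
  · exact div_pos (mul_pos_of_neg_of_neg (by linarith) (by linarith))
      (mul_pos_of_neg_of_neg (by linarith) (by linarith))
  · exact div_pos_of_neg_of_neg (mul_neg_of_pos_of_neg (by linarith) (by linarith))
      (mul_neg_of_neg_of_pos (by linarith) (by linarith))
  · exact div_pos (mul_pos (by linarith) (by linarith)) (mul_pos (by linarith) (by linarith))

theorem gammaOf_sq {ε : Fin 3 → ℝ} (hε : ∀ j, ε j = 1 ∨ ε j = -1) {l : Fin 2 → ℝ}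
    (hl : l ∈ B.coordDomain) (j : Fin 3) : B.gammaOf ε l j ^ 2 = B.gammaSq l j := by
  rw [gammaOf, mul_pow, Real.sq_sqrt (B.gammaSq_pos hl j).le]
  rcases hε j with h | h <;> rw [h] <;> ring

theorem gammaOf_ne_zero {ε : Fin 3 → ℝ} (hε : ∀ j, ε j = 1 ∨ ε j = -1) {l : Fin 2 → ℝ}
    (hl : l ∈ B.coordDomain) (j : Fin 3) : B.gammaOf ε l j ≠ 0 := by
  intro h
  have := B.gammaOf_sq hε hl j
  rw [h] at this
  exact (B.gammaSq_pos hl j).ne (by simpa using this)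

/-- The elementary symmetric functions of the coordinates are quadratic forms in `γ`. -/
theorem gammaOf_moments {ε : Fin 3 → ℝ} (hε : ∀ j, ε j = 1 ∨ ε j = -1) {l : Fin 2 → ℝ}
    (hl : l ∈ B.coordDomain) :
    B.gammaOf ε l 0 ^ 2 + B.gammaOf ε l 1 ^ 2 + B.gammaOf ε l 2 ^ 2 = 1 ∧
    (B.inertia 1 + B.inertia 2) * B.gammaOf ε l 0 ^ 2
      + (B.inertia 0 + B.inertia 2) * B.gammaOf ε l 1 ^ 2
      + (B.inertia 0 + B.inertia 1) * B.gammaOf ε l 2 ^ 2 = l 0 + l 1 ∧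
    B.inertia 1 * B.inertia 2 * B.gammaOf ε l 0 ^ 2
      + B.inertia 0 * B.inertia 2 * B.gammaOf ε l 1 ^ 2
      + B.inertia 0 * B.inertia 1 * B.gammaOf ε l 2 ^ 2 = l 0 * l 1 := by
  have h1 : B.inertia 0 - B.inertia 1 ≠ 0 := sub_ne_zero.2 B.inertia_lt₁.ne
  have h2 : B.inertia 1 - B.inertia 2 ≠ 0 := sub_ne_zero.2 B.inertia_lt₂.ne
  have h3 : B.inertia 0 - B.inertia 2 ≠ 0 := sub_ne_zero.2 (B.inertia_lt₁.trans B.inertia_lt₂).ne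
  have h1' : B.inertia 1 - B.inertia 0 ≠ 0 := sub_ne_zero.2 B.inertia_lt₁.ne'
  have h2' : B.inertia 2 - B.inertia 1 ≠ 0 := sub_ne_zero.2 B.inertia_lt₂.ne'
  have h3' : B.inertia 2 - B.inertia 0 ≠ 0 := sub_ne_zero.2 (B.inertia_lt₁.trans B.inertia_lt₂).ne'
  simp only [B.gammaOf_sq hε hl, gammaSq, Matrix.cons_val]
  refine ⟨?_, ?_, ?_⟩ <;> field_simp <;> ring

theorem gammaOf_dot_self {ε : Fin 3 → ℝ} (hε : ∀ j, ε j = 1 ∨ ε j = -1) {l : Fin 2 → ℝ}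
    (hl : l ∈ B.coordDomain) : B.gammaOf ε l ⬝ᵥ B.gammaOf ε l = 1 := by
  rw [Matrix.vec3_dotProduct, ← (B.gammaOf_moments hε hl).1]
  ring

theorem gammaOf_bijOn {ε : Fin 3 → ℝ} (hε : ∀ j, ε j = 1 ∨ ε j = -1) :
    Set.BijOn (B.gammaOf ε) B.coordDomain (octant ε) := by
  refine ⟨fun l hl => ⟨B.gammaOf_dot_self hε hl, fun j => ?_⟩, fun l hl l' hl' h => ?_,
    fun g hg => ?_⟩
  · have h := Real.sqrt_pos.2 (B.gammaSq_pos hl j)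
    rcases hε j with e | e <;> simp [gammaOf, e, h]
  · obtain ⟨-, hs, hp⟩ := B.gammaOf_moments hε hl
    obtain ⟨-, hs', hp'⟩ := B.gammaOf_moments hε hl'
    rw [h] at hs hp
    rw [hs] at hs'
    rw [hp] at hp'
    obtain ⟨-, h1, h2, -⟩ := hl
    obtain ⟨-, h1', h2', -⟩ := hl'
    have h0 : (l 0 - l' 0) * (l 0 - l' 1) = 0 := by linear_combination l 0 * hs' - hp'
    have h0' : l 0 = l' 0 := by
      rcases mul_eq_zero.1 h0 with h0 | h0 <;> linarith
    ext i
    fin_cases i <;> dsimp <;> linarith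
  · obtain ⟨hg1, hgε⟩ := hg
    rw [Matrix.vec3_dotProduct] at hg1
    have hpos : ∀ j, 0 < g j ^ 2 := fun j => by
      have : g j ≠ 0 := fun h => by simpa [h] using hgε j
      positivity
    have h5 := B.inertia_lt₁
    have h6 := B.inertia_lt₂
    -- The coordinates of `g` are the roots of `∑ⱼ gⱼ² ∏_{k ≠ j} (x - Iₖ)`.
    set f : ℝ → ℝ := fun x => g 0 ^ 2 * ((x - B.inertia 1) * (x - B.inertia 2))
      + g 1 ^ 2 * ((x - B.inertia 0) * (x - B.inertia 2))
      + g 2 ^ 2 * ((x - B.inertia 0) * (x - B.inertia 1)) with hf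
    have hfc : Continuous f := by rw [hf]; fun_prop
    have f0 : 0 < f (B.inertia 0) := by
      have := mul_pos (hpos 0) (mul_pos_of_neg_of_neg (sub_neg.2 h5) (sub_neg.2 (h5.trans h6)))
      simpa [hf] using this
    have f1 : f (B.inertia 1) < 0 := by
      have := mul_neg_of_pos_of_neg (hpos 1)
        (mul_neg_of_pos_of_neg (sub_pos.2 h5) (sub_neg.2 h6))
      simpa [hf] using this
    have f2 : 0 < f (B.inertia 2) := by
      have := mul_pos (hpos 2) (mul_pos (sub_pos.2 (h5.trans h6)) (sub_pos.2 h6))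
      simpa [hf] using this
    obtain ⟨x, ⟨hx0, hx1⟩, hx⟩ := intermediate_value_Ioo' h5.le hfc.continuousOn ⟨f1, f0⟩
    obtain ⟨y, ⟨hy0, hy1⟩, hy⟩ := intermediate_value_Ioo h6.le hfc.continuousOn ⟨f1, f2⟩
    have hfac : ∀ w, f w = (w - x) * (w - y) := by
      have hxy : x - y ≠ 0 := by linarith
      intro w
      apply mul_left_cancel₀ hxy
      simp only [hf] at hx hy ⊢
      linear_combination (w - y) * hx - (w - x) * hy + (x - y) * (w - x) * (w - y) * hg1
    have hl : ![x, y] ∈ B.coordDomain := ⟨hx0, hx1, hy0, hy1⟩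
    have hsq : ∀ j, B.gammaSq ![x, y] j = g j ^ 2 := by
      have e0 := hfac (B.inertia 0)
      have e1 := hfac (B.inertia 1)
      have e2 := hfac (B.inertia 2)
      have h1 : B.inertia 0 - B.inertia 1 ≠ 0 := by linarith
      have h2 : B.inertia 1 - B.inertia 2 ≠ 0 := by linarith
      have h3 : B.inertia 0 - B.inertia 2 ≠ 0 := by linarith
      have h1' : B.inertia 1 - B.inertia 0 ≠ 0 := by linarith
      have h2' : B.inertia 2 - B.inertia 1 ≠ 0 := by linarith
      have h3' : B.inertia 2 - B.inertia 0 ≠ 0 := by linarith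
      simp only [hf, sub_self] at e0 e1 e2
      intro j
      fin_cases j <;> simp only [gammaSq, Matrix.cons_val] <;> dsimp <;>
        refine (div_eq_iff (by positivity)).2 ?_
      · linear_combination -e0
      · linear_combination -e1
      · linear_combination -e2
    refine ⟨![x, y], hl, funext fun j => ?_⟩
    have := hgε j
    rw [gammaOf, hsq, Real.sqrt_sq_eq_abs]
    rcases hε j with e | e <;> rw [e] at this ⊢
    · rw [abs_of_pos (by linarith)]; ring
    · rw [abs_of_neg (by linarith)]; ring

/-- The quadric `F` is the product of the shifted coordinates. -/
theorem F_gammaOf {ε : Fin 3 → ℝ} (hε : ∀ j, ε j = 1 ∨ ε j = -1) {l : Fin 2 → ℝ}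
    (hl : l ∈ B.coordDomain) : B.F (B.gammaOf ε l) =
      (1 + B.b / B.a) ^ 2 * (l 0 + B.μ * B.b ^ 2) * (l 1 + B.μ * B.b ^ 2) := by
  obtain ⟨h1, h2, h3⟩ := B.gammaOf_moments hε hl
  have i0 := B.inertia_pos.ne'
  have i1 := (B.inertia_pos.trans B.inertia_lt₁).ne'
  have i2 := (B.inertia_pos.trans (B.inertia_lt₁.trans B.inertia_lt₂)).ne'
  have key : B.F (B.gammaOf ε l) = (1 + B.b / B.a) ^ 2 *
      ((B.inertia 1 * B.inertia 2 * B.gammaOf ε l 0 ^ 2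
      + B.inertia 0 * B.inertia 2 * B.gammaOf ε l 1 ^ 2
      + B.inertia 0 * B.inertia 1 * B.gammaOf ε l 2 ^ 2) + B.μ * B.b ^ 2 *
      ((B.inertia 1 + B.inertia 2) * B.gammaOf ε l 0 ^ 2
      + (B.inertia 0 + B.inertia 2) * B.gammaOf ε l 1 ^ 2
      + (B.inertia 0 + B.inertia 1) * B.gammaOf ε l 2 ^ 2) + (B.μ * B.b ^ 2) ^ 2) := by
    rw [F]
    generalize 1 + B.b / B.a = k
    field_simp
    ring
  rw [key, h2, h3]
  ring

theorem isOpen_coordDomain : IsOpen B.coordDomain := by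
  simp only [coordDomain, Set.ofPred_and]
  refine (isOpen_lt ?_ ?_).inter ((isOpen_lt ?_ ?_).inter ((isOpen_lt ?_ ?_).inter
    (isOpen_lt ?_ ?_))) <;> fun_prop

theorem update_eventually_mem_coordDomain {l : Fin 2 → ℝ} (hl : l ∈ B.coordDomain) (i : Fin 2) :
    ∀ᶠ x in nhds (l i), Function.update l i x ∈ B.coordDomain := by
  have hc : Continuous fun x => Function.update l i x := by fun_prop
  refine hc.continuousAt.eventually_mem (B.isOpen_coordDomain.mem_nhds ?_)
  simpa using hl

/-! ### The coordinate frame -/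

/-- The coordinate vector `∂γ/∂λᵢ` at the point `g` with sphero-conical coordinates `l`. -/
noncomputable def frame (g : Fin 3 → ℝ) (l : Fin 2 → ℝ) (i : Fin 2) : Fin 3 → ℝ :=
  fun j => g j / (2 * (l i - B.inertia j))

/-- The second derivative `∂²γ/∂λᵢ∂λₘ` at the point `g` with sphero-conical coordinates `l`. -/
noncomputable def frameDeriv (g : Fin 3 → ℝ) (l : Fin 2 → ℝ) (i m : Fin 2) : Fin 3 → ℝ :=
  fun j => (if i = m then -1 else 1) * g j / (4 * (l i - B.inertia j) * (l m - B.inertia j))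

/-- The vector `∂γ/∂λᵢ × γ`: up to the factor `1 + b/a`, the body angular velocity of the
horizontal lift of `∂γ/∂λᵢ`. -/
noncomputable def lift (g : Fin 3 → ℝ) (l : Fin 2 → ℝ) (i : Fin 2) : Fin 3 → ℝ :=
  B.frame g l i ⨯₃ g

/-- The derivative of `lift i` with respect to `λₘ`. -/
noncomputable def liftDeriv (g : Fin 3 → ℝ) (l : Fin 2 → ℝ) (i m : Fin 2) : Fin 3 → ℝ :=
  B.frameDeriv g l i m ⨯₃ g + B.frame g l i ⨯₃ B.frame g l m

/-- The bilinear form of `A + μ b²`, the inertia operator of the ball about the contact point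
restricted to the angular velocities without twist. -/
noncomputable def contactForm (x y : Fin 3 → ℝ) : ℝ :=
  ∑ j, (B.inertia j + B.μ * B.b ^ 2) * x j * y j

theorem frameDeriv_comm (g : Fin 3 → ℝ) (l : Fin 2 → ℝ) (i m : Fin 2) :
    B.frameDeriv g l i m = B.frameDeriv g l m i := by
  ext j
  simp only [frameDeriv, eq_comm (a := i)]
  rw [mul_right_comm]

theorem hasDerivAt_cross {f g : ℝ → Fin 3 → ℝ} {f' g' : Fin 3 → ℝ} {t : ℝ}
    (hf : HasDerivAt f f' t) (hg : HasDerivAt g g' t) :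
    HasDerivAt (fun s => f s ⨯₃ g s) (f' ⨯₃ g t + f t ⨯₃ g') t := by
  rw [hasDerivAt_pi] at hf hg ⊢
  intro j
  fin_cases j <;> simp only [cross_apply] <;> dsimp
  · exact (((hf 1).mul (hg 2)).sub ((hf 2).mul (hg 1))).congr_deriv (by ring)
  · exact (((hf 2).mul (hg 0)).sub ((hf 0).mul (hg 2))).congr_deriv (by ring)
  · exact (((hf 0).mul (hg 1)).sub ((hf 1).mul (hg 0))).congr_deriv (by ring)

theorem hasDerivAt_contactForm {f g : ℝ → Fin 3 → ℝ} {f' g' : Fin 3 → ℝ} {t : ℝ}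
    (hf : HasDerivAt f f' t) (hg : HasDerivAt g g' t) :
    HasDerivAt (fun s => B.contactForm (f s) (g s))
      (B.contactForm f' (g t) + B.contactForm (f t) g') t := by
  rw [hasDerivAt_pi] at hf hg
  simp only [contactForm]
  refine (HasDerivAt.fun_sum fun j _ => ((hf j).const_mul _).mul (hg j)).congr_deriv ?_
  rw [Finset.sum_add_distrib]

theorem hasDerivAt_gammaOf {ε : Fin 3 → ℝ} {l : Fin 2 → ℝ} (hl : l ∈ B.coordDomain) (i : Fin 2) :
    HasDerivAt (fun x => B.gammaOf ε (Function.update l i x)) (B.frame (B.gammaOf ε l) l i)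
      (l i) := by
  rw [hasDerivAt_pi]
  intro j
  have hne := B.coordDomain_ne hl
  have hsq : HasDerivAt (fun x => B.gammaSq (Function.update l i x) j)
      (B.gammaSq l j / (l i - B.inertia j)) (l i) := by
    have hlin : HasDerivAt (fun x : ℝ => B.inertia j - x) (-1) (l i) := by
      simpa using (hasDerivAt_id (l i)).const_sub (B.inertia j)
    have h0 := hne 0 j
    have h1 := hne 1 j
    fin_cases i <;> fin_cases j <;> simp only [gammaSq] <;> dsimp at * <;>
      simp only [ne_eq, zero_ne_one, one_ne_zero, not_false_eq_true, Function.update_self,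
        Function.update_of_ne]
    any_goals
      refine ((hlin.mul_const _).div_const _).congr_deriv ?_
      rw [div_right_comm]
      congr 1
      field_simp
      ring
    all_goals
      refine ((hlin.const_mul _).div_const _).congr_deriv ?_
      rw [div_right_comm]
      congr 1
      field_simp
      ring
  have hpos := B.gammaSq_pos hl j
  have h := (hsq.sqrt (by simpa using hpos.ne')).const_mul (ε j)
  refine h.congr_deriv ?_
  simp only [frame, gammaOf, Function.update_eq_self]
  have hs := Real.sqrt_ne_zero'.2 hpos
  have hj := hne i j
  field_simp
  rw [Real.sq_sqrt hpos.le]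

theorem coordVector_eq {ε : Fin 3 → ℝ} {l : Fin 2 → ℝ} (hl : l ∈ B.coordDomain) (i : Fin 2) :
    B.coordVector ε l i = B.frame (B.gammaOf ε l) l i :=
  (B.hasDerivAt_gammaOf hl i).deriv

theorem hasDerivAt_frame {g : ℝ → Fin 3 → ℝ} {l : ℝ → Fin 2 → ℝ} {u : Fin 2 → ℝ} {t : ℝ}
    (hlt : l t ∈ B.coordDomain) (hl : HasDerivAt l u t)
    (hg : HasDerivAt g (∑ m, u m • B.frame (g t) (l t) m) t) (i : Fin 2) :
    HasDerivAt (fun s => B.frame (g s) (l s) i) (∑ m, u m • B.frameDeriv (g t) (l t) i m) t := by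
  rw [hasDerivAt_pi] at hl hg ⊢
  intro j
  have h0 := B.coordDomain_ne hlt 0 j
  have h1 := B.coordDomain_ne hlt 1 j
  refine ((hg j).div (((hl i).sub_const (B.inertia j)).const_mul 2)
    (mul_ne_zero two_ne_zero (B.coordDomain_ne hlt i j))).congr_deriv ?_
  fin_cases i <;> simp [frame, frameDeriv] <;> field_simp <;> ring

/-- The derivative of `lift i` along a curve whose sphero-conical coordinates have velocity `u`. -/
theorem hasDerivAt_lift {g : ℝ → Fin 3 → ℝ} {l : ℝ → Fin 2 → ℝ} {u : Fin 2 → ℝ} {t : ℝ}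
    (hlt : l t ∈ B.coordDomain) (hl : HasDerivAt l u t)
    (hg : HasDerivAt g (∑ m, u m • B.frame (g t) (l t) m) t) (i : Fin 2) :
    HasDerivAt (fun s => B.lift (g s) (l s) i) (∑ m, u m • B.liftDeriv (g t) (l t) i m) t := by
  refine (hasDerivAt_cross (B.hasDerivAt_frame hlt hl hg i) hg).congr_deriv ?_
  simp only [liftDeriv, Fin.sum_univ_two, map_add, map_smul, LinearMap.add_apply,
    LinearMap.smul_apply, smul_add]
  abel

theorem hasDerivAt_lift_gammaOf {ε : Fin 3 → ℝ} {l : Fin 2 → ℝ} (hl : l ∈ B.coordDomain)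
    (i m : Fin 2) :
    HasDerivAt (fun x => B.lift (B.gammaOf ε (Function.update l m x)) (Function.update l m x) i)
      (B.liftDeriv (B.gammaOf ε l) l i m) (l m) := by
  have h := B.hasDerivAt_lift (g := fun x => B.gammaOf ε (Function.update l m x))
    (l := fun x => Function.update l m x) (u := Pi.single m 1) (t := l m) (by simpa using hl)
    (hasDerivAt_update l m (l m))
    ((B.hasDerivAt_gammaOf hl m).congr_deriv (by
      fin_cases m <;> simp)) i
  refine h.congr_deriv ?_
  fin_cases m <;> simp

/-! ### The metric of the horizontal lifts -/

theorem shift_pos {l : Fin 2 → ℝ} (hl : l ∈ B.coordDomain) (i : Fin 2) :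
    0 < l i + B.μ * B.b ^ 2 := by
  obtain ⟨h1, h2, h3, h4⟩ := hl
  have h5 := B.inertia_lt₁
  have h6 := B.inertia_pos
  have h7 := mul_nonneg B.mu_pos.le (sq_nonneg B.b)
  fin_cases i <;> dsimp <;> linarith

theorem prodShift_pos {l : Fin 2 → ℝ} (hl : l ∈ B.coordDomain) : 0 < B.prodShift l :=
  mul_pos (B.shift_pos hl 0) (B.shift_pos hl 1)

theorem ratio_ne_zero : 1 + B.b / B.a ≠ 0 := by
  have h := B.add_ne
  have ha := B.a_pos.ne'
  rw [show 1 + B.b / B.a = (B.a + B.b) / B.a by field_simp]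
  exact div_ne_zero h ha

/-- The coefficients `c₁`, `c₂` as a family. -/
noncomputable def c (l : Fin 2 → ℝ) : Fin 2 → ℝ := ![B.c₁ l, B.c₂ l]

theorem c_pos {l : Fin 2 → ℝ} (hl : l ∈ B.coordDomain) (i : Fin 2) : 0 < B.c l i := by
  have hk : 0 < (1 + B.b / B.a) ^ 2 := by have := B.ratio_ne_zero; positivity
  have s0 := B.shift_pos hl 0
  have s1 := B.shift_pos hl 1
  obtain ⟨h1, h2, h3, h4⟩ := hl
  have h6 := B.inertia_lt₂
  have h5 := B.inertia_lt₁
  fin_cases i <;> simp only [c, c₁, c₂] <;> dsimp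
  · exact mul_pos (mul_pos (mul_pos (by norm_num) hk) (by linarith)) (div_pos s1
      (mul_pos (mul_pos (by linarith) (by linarith)) (by linarith)))
  · exact mul_pos (mul_pos (mul_pos (by norm_num) hk) (by linarith)) (div_pos s0
      (mul_pos (mul_pos (by linarith) (by linarith)) (by linarith)))

theorem lift_apply {l : Fin 2 → ℝ} (hl : l ∈ B.coordDomain) (g : Fin 3 → ℝ) (i : Fin 2) :
    B.lift g l i =
      ![g 1 * g 2 * ((B.inertia 1 - B.inertia 2) /
          (2 * (l i - B.inertia 1) * (l i - B.inertia 2))),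
        g 2 * g 0 * ((B.inertia 2 - B.inertia 0) /
          (2 * (l i - B.inertia 2) * (l i - B.inertia 0))),
        g 0 * g 1 * ((B.inertia 0 - B.inertia 1) /
          (2 * (l i - B.inertia 0) * (l i - B.inertia 1)))] := by
  have h0 := B.coordDomain_ne hl i 0
  have h1 := B.coordDomain_ne hl i 1
  have h2 := B.coordDomain_ne hl i 2
  simp only [lift, frame, cross_apply]
  congr 1
  · field_simp; ring
  congr 1
  · field_simp; ring
  congr 1
  · field_simp; ring

theorem inertia_sub_ne {i j : Fin 3} (h : i ≠ j) : B.inertia i - B.inertia j ≠ 0 := by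
  have h1 := B.inertia_lt₁
  have h2 := B.inertia_lt₂
  apply sub_ne_zero.2
  fin_cases i <;> fin_cases j <;> first | exact absurd rfl h | (dsimp; linarith)

theorem gammaOf_sq_eq {ε : Fin 3 → ℝ} (hε : ∀ j, ε j = 1 ∨ ε j = -1) {l : Fin 2 → ℝ}
    (hl : l ∈ B.coordDomain) :
    B.gammaOf ε l 0 ^ 2 = (l 0 - B.inertia 0) * (l 1 - B.inertia 0) /
      ((B.inertia 0 - B.inertia 1) * (B.inertia 0 - B.inertia 2)) ∧
    B.gammaOf ε l 1 ^ 2 = -((l 0 - B.inertia 1) * (l 1 - B.inertia 1)) /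
      ((B.inertia 0 - B.inertia 1) * (B.inertia 1 - B.inertia 2)) ∧
    B.gammaOf ε l 2 ^ 2 = (l 0 - B.inertia 2) * (l 1 - B.inertia 2) /
      ((B.inertia 0 - B.inertia 2) * (B.inertia 1 - B.inertia 2)) := by
  have h01 := B.inertia_sub_ne (i := 0) (j := 1) (by decide)
  have h02 := B.inertia_sub_ne (i := 0) (j := 2) (by decide)
  have h12 := B.inertia_sub_ne (i := 1) (j := 2) (by decide)
  have h10 := B.inertia_sub_ne (i := 1) (j := 0) (by decide)
  have h20 := B.inertia_sub_ne (i := 2) (j := 0) (by decide)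
  have h21 := B.inertia_sub_ne (i := 2) (j := 1) (by decide)
  simp only [B.gammaOf_sq hε hl, gammaSq, Matrix.cons_val]
  refine ⟨?_, ?_, ?_⟩
  · rw [div_eq_div_iff (mul_ne_zero h02 h01) (mul_ne_zero h01 h02)]; ring
  · rw [div_eq_div_iff (mul_ne_zero h12 h10) (mul_ne_zero h01 h12)]; ring
  · rw [div_eq_div_iff (mul_ne_zero h20 h21) (mul_ne_zero h02 h12)]; ring

theorem c_zero (l : Fin 2 → ℝ) : B.c l 0 = 1 / 4 * (1 + B.b / B.a) ^ 2 * (l 1 - l 0) *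
    (l 1 + B.μ * B.b ^ 2) /
      ((l 0 - B.inertia 0) * (l 0 - B.inertia 1) * (l 0 - B.inertia 2)) := by
  rw [c, c₁, Matrix.cons_val_zero, mul_div_assoc]
  congr 2
  ring

theorem c_one (l : Fin 2 → ℝ) : B.c l 1 = 1 / 4 * (1 + B.b / B.a) ^ 2 * (l 0 - l 1) *
    (l 0 + B.μ * B.b ^ 2) /
      ((l 1 - B.inertia 0) * (l 1 - B.inertia 1) * (l 1 - B.inertia 2)) := by
  rw [c, c₂, Matrix.cons_val_one, Matrix.cons_val_fin_one, ← mul_div_assoc, ← neg_div_neg_eq]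
  congr 1 <;> ring

/-- The reduced metric is `∑ cᵢ dλᵢ²`: the diagonal coefficients. -/
theorem contactForm_lift_self {ε : Fin 3 → ℝ} (hε : ∀ j, ε j = 1 ∨ ε j = -1) {l : Fin 2 → ℝ}
    (hl : l ∈ B.coordDomain) (i : Fin 2) :
    (1 + B.b / B.a) ^ 2 * B.contactForm (B.lift (B.gammaOf ε l) l i) (B.lift (B.gammaOf ε l) l i)
      = B.c l i := by
  have h01 := B.inertia_sub_ne (i := 0) (j := 1) (by decide)
  have h02 := B.inertia_sub_ne (i := 0) (j := 2) (by decide)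
  have h12 := B.inertia_sub_ne (i := 1) (j := 2) (by decide)
  obtain ⟨g0, g1, g2⟩ := B.gammaOf_sq_eq hε hl
  have n := B.coordDomain_ne hl
  have n00 := n 0 0
  have n01 := n 0 1
  have n02 := n 0 2
  have n10 := n 1 0
  have n11 := n 1 1
  have n12 := n 1 2
  have key : B.contactForm (B.lift (B.gammaOf ε l) l i) (B.lift (B.gammaOf ε l) l i) =
      (B.inertia 0 + B.μ * B.b ^ 2) * (B.gammaOf ε l 1 ^ 2 * B.gammaOf ε l 2 ^ 2) *
        ((B.inertia 1 - B.inertia 2) / (2 * (l i - B.inertia 1) * (l i - B.inertia 2))) ^ 2 +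
      (B.inertia 1 + B.μ * B.b ^ 2) * (B.gammaOf ε l 2 ^ 2 * B.gammaOf ε l 0 ^ 2) *
        ((B.inertia 2 - B.inertia 0) / (2 * (l i - B.inertia 2) * (l i - B.inertia 0))) ^ 2 +
      (B.inertia 2 + B.μ * B.b ^ 2) * (B.gammaOf ε l 0 ^ 2 * B.gammaOf ε l 1 ^ 2) *
        ((B.inertia 0 - B.inertia 1) / (2 * (l i - B.inertia 0) * (l i - B.inertia 1))) ^ 2 := by
    simp only [B.lift_apply hl, contactForm, Fin.sum_univ_three, Matrix.cons_val]
    ring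
  rw [key, g0, g1, g2]
  fin_cases i <;> dsimp
  · rw [c_zero]
    generalize 1 + B.b / B.a = k
    generalize B.μ * B.b ^ 2 = m
    field_simp
    ring
  · rw [c_one]
    generalize 1 + B.b / B.a = k
    generalize B.μ * B.b ^ 2 = m
    field_simp
    ring

/-- The sphero-conical coordinates are orthogonal for the reduced metric. -/
theorem contactForm_lift_zero_one {ε : Fin 3 → ℝ} (hε : ∀ j, ε j = 1 ∨ ε j = -1) {l : Fin 2 → ℝ}
    (hl : l ∈ B.coordDomain) :
    B.contactForm (B.lift (B.gammaOf ε l) l 0) (B.lift (B.gammaOf ε l) l 1) = 0 := by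
  have h01 := B.inertia_sub_ne (i := 0) (j := 1) (by decide)
  have h02 := B.inertia_sub_ne (i := 0) (j := 2) (by decide)
  have h12 := B.inertia_sub_ne (i := 1) (j := 2) (by decide)
  obtain ⟨g0, g1, g2⟩ := B.gammaOf_sq_eq hε hl
  have n := B.coordDomain_ne hl
  have n00 := n 0 0
  have n01 := n 0 1
  have n02 := n 0 2
  have n10 := n 1 0
  have n11 := n 1 1
  have n12 := n 1 2
  have key : B.contactForm (B.lift (B.gammaOf ε l) l 0) (B.lift (B.gammaOf ε l) l 1) =
      (B.inertia 0 + B.μ * B.b ^ 2) * (B.gammaOf ε l 1 ^ 2 * B.gammaOf ε l 2 ^ 2) *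
        ((B.inertia 1 - B.inertia 2) / (2 * (l 0 - B.inertia 1) * (l 0 - B.inertia 2)) *
        ((B.inertia 1 - B.inertia 2) / (2 * (l 1 - B.inertia 1) * (l 1 - B.inertia 2)))) +
      (B.inertia 1 + B.μ * B.b ^ 2) * (B.gammaOf ε l 2 ^ 2 * B.gammaOf ε l 0 ^ 2) *
        ((B.inertia 2 - B.inertia 0) / (2 * (l 0 - B.inertia 2) * (l 0 - B.inertia 0)) *
        ((B.inertia 2 - B.inertia 0) / (2 * (l 1 - B.inertia 2) * (l 1 - B.inertia 0)))) +
      (B.inertia 2 + B.μ * B.b ^ 2) * (B.gammaOf ε l 0 ^ 2 * B.gammaOf ε l 1 ^ 2) *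
        ((B.inertia 0 - B.inertia 1) / (2 * (l 0 - B.inertia 0) * (l 0 - B.inertia 1)) *
        ((B.inertia 0 - B.inertia 1) / (2 * (l 1 - B.inertia 0) * (l 1 - B.inertia 1)))) := by
    simp only [B.lift_apply hl, contactForm, Fin.sum_univ_three, Matrix.cons_val]
    ring
  rw [key, g0, g1, g2]
  generalize B.μ * B.b ^ 2 = m
  field_simp
  ring

/-- The oriented area `det (∂γ/∂λ₁, ∂γ/∂λ₂, γ)` of the coordinate frame. -/
noncomputable def area (g : Fin 3 → ℝ) (l : Fin 2 → ℝ) : ℝ :=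
  B.frame g l 0 ⬝ᵥ B.lift g l 1

theorem area_eq {l : Fin 2 → ℝ} (hl : l ∈ B.coordDomain) (g : Fin 3 → ℝ) : B.area g l =
    g 0 * g 1 * g 2 * ((B.inertia 0 - B.inertia 1) * (B.inertia 1 - B.inertia 2) *
      (B.inertia 0 - B.inertia 2) * (l 1 - l 0) / (4 * ((l 0 - B.inertia 0) * (l 0 - B.inertia 1) *
      (l 0 - B.inertia 2) * (l 1 - B.inertia 0) * (l 1 - B.inertia 1) * (l 1 - B.inertia 2)))) := by
  have n := B.coordDomain_ne hl
  have n00 := n 0 0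
  have n01 := n 0 1
  have n02 := n 0 2
  have n10 := n 1 0
  have n11 := n 1 1
  have n12 := n 1 2
  simp only [area, B.lift_apply hl, frame, Matrix.vec3_dotProduct, Matrix.cons_val]
  field_simp
  ring

theorem contactForm_lift_left {l : Fin 2 → ℝ} (hl : l ∈ B.coordDomain) (g : Fin 3 → ℝ)
    (i : Fin 2) : B.contactForm (B.lift g l i) g =
    g 0 * g 1 * g 2 * (-(B.inertia 0 - B.inertia 1) * (B.inertia 1 - B.inertia 2) *
      (B.inertia 0 - B.inertia 2) / (2 * ((l i - B.inertia 0) * (l i - B.inertia 1) *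
      (l i - B.inertia 2)))) := by
  have n0 := B.coordDomain_ne hl i 0
  have n1 := B.coordDomain_ne hl i 1
  have n2 := B.coordDomain_ne hl i 2
  simp only [contactForm, B.lift_apply hl, Fin.sum_univ_three, Matrix.cons_val]
  field_simp
  ring

/-- With `area_mul_contactForm_one`, this identifies the gyroscopic coefficients
`(A (∂γ/∂λᵢ × γ), γ)` with the metric coefficients, which makes the gyroscopic force that of a
multiplier depending on `(λ₁ + μb²)(λ₂ + μb²)` alone. -/
theorem area_mul_contactForm_zero {ε : Fin 3 → ℝ} (hε : ∀ j, ε j = 1 ∨ ε j = -1) {l : Fin 2 → ℝ}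
    (hl : l ∈ B.coordDomain) :
    (1 + B.b / B.a) ^ 2 * (B.area (B.gammaOf ε l) l *
      B.contactForm (B.lift (B.gammaOf ε l) l 0) (B.gammaOf ε l)) * (2 * (l 1 + B.μ * B.b ^ 2))
      = B.c l 0 := by
  have h01 := B.inertia_sub_ne (i := 0) (j := 1) (by decide)
  have h02 := B.inertia_sub_ne (i := 0) (j := 2) (by decide)
  have h12 := B.inertia_sub_ne (i := 1) (j := 2) (by decide)
  obtain ⟨g0, g1, g2⟩ := B.gammaOf_sq_eq hε hl
  have n := B.coordDomain_ne hl
  have n00 := n 0 0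
  have n01 := n 0 1
  have n02 := n 0 2
  have n10 := n 1 0
  have n11 := n 1 1
  have n12 := n 1 2
  rw [B.area_eq hl, B.contactForm_lift_left hl, mul_mul_mul_comm (B.gammaOf ε l 0 * _ * _),
    show B.gammaOf ε l 0 * B.gammaOf ε l 1 * B.gammaOf ε l 2 *
      (B.gammaOf ε l 0 * B.gammaOf ε l 1 * B.gammaOf ε l 2) =
      B.gammaOf ε l 0 ^ 2 * B.gammaOf ε l 1 ^ 2 * B.gammaOf ε l 2 ^ 2 by ring, g0, g1, g2]
  rw [c_zero]
  generalize 1 + B.b / B.a = k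
  generalize B.μ * B.b ^ 2 = m
  field_simp

theorem area_mul_contactForm_one {ε : Fin 3 → ℝ} (hε : ∀ j, ε j = 1 ∨ ε j = -1) {l : Fin 2 → ℝ}
    (hl : l ∈ B.coordDomain) :
    (1 + B.b / B.a) ^ 2 * (B.area (B.gammaOf ε l) l *
      B.contactForm (B.lift (B.gammaOf ε l) l 1) (B.gammaOf ε l)) * (2 * (l 0 + B.μ * B.b ^ 2))
      = -B.c l 1 := by
  have h01 := B.inertia_sub_ne (i := 0) (j := 1) (by decide)
  have h02 := B.inertia_sub_ne (i := 0) (j := 2) (by decide)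
  have h12 := B.inertia_sub_ne (i := 1) (j := 2) (by decide)
  obtain ⟨g0, g1, g2⟩ := B.gammaOf_sq_eq hε hl
  have n := B.coordDomain_ne hl
  have n00 := n 0 0
  have n01 := n 0 1
  have n02 := n 0 2
  have n10 := n 1 0
  have n11 := n 1 1
  have n12 := n 1 2
  rw [B.area_eq hl, B.contactForm_lift_left hl, mul_mul_mul_comm (B.gammaOf ε l 0 * _ * _),
    show B.gammaOf ε l 0 * B.gammaOf ε l 1 * B.gammaOf ε l 2 *
      (B.gammaOf ε l 0 * B.gammaOf ε l 1 * B.gammaOf ε l 2) =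
      B.gammaOf ε l 0 ^ 2 * B.gammaOf ε l 1 ^ 2 * B.gammaOf ε l 2 ^ 2 by ring, g0, g1, g2]
  rw [c_one]
  generalize 1 + B.b / B.a = k
  generalize B.μ * B.b ^ 2 = m
  field_simp
  ring

/-! ### The momenta -/

theorem contactForm_comm (x y : Fin 3 → ℝ) : B.contactForm x y = B.contactForm y x := by
  simp only [contactForm]
  exact Finset.sum_congr rfl fun j _ => by ring

theorem contactForm_sum_left (u : Fin 2 → ℝ) (x : Fin 2 → Fin 3 → ℝ) (y : Fin 3 → ℝ) :
    B.contactForm (∑ m, u m • x m) y = u 0 * B.contactForm (x 0) y + u 1 * B.contactForm (x 1) y := by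
  simp only [contactForm, Fin.sum_univ_two, Fin.sum_univ_three, Pi.add_apply, Pi.smul_apply,
    smul_eq_mul]
  ring

theorem contactForm_sum_right (u : Fin 2 → ℝ) (x : Fin 2 → Fin 3 → ℝ) (y : Fin 3 → ℝ) :
    B.contactForm y (∑ m, u m • x m) = u 0 * B.contactForm y (x 0) + u 1 * B.contactForm y (x 1) := by
  simp only [contactForm_comm _ y, contactForm_sum_left]

theorem frame_dot {ε : Fin 3 → ℝ} (hε : ∀ j, ε j = 1 ∨ ε j = -1) {l : Fin 2 → ℝ}
    (hl : l ∈ B.coordDomain) (i : Fin 2) :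
    B.frame (B.gammaOf ε l) l i ⬝ᵥ B.gammaOf ε l = 0 := by
  have h01 := B.inertia_sub_ne (i := 0) (j := 1) (by decide)
  have h02 := B.inertia_sub_ne (i := 0) (j := 2) (by decide)
  have h12 := B.inertia_sub_ne (i := 1) (j := 2) (by decide)
  obtain ⟨g0, g1, g2⟩ := B.gammaOf_sq_eq hε hl
  have n := B.coordDomain_ne hl
  have n00 := n 0 0
  have n01 := n 0 1
  have n02 := n 0 2
  have n10 := n 1 0
  have n11 := n 1 1
  have n12 := n 1 2
  rw [Matrix.vec3_dotProduct]
  simp only [frame, div_mul_eq_mul_div, ← sq, g0, g1, g2]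
  fin_cases i <;> dsimp <;> field_simp <;> ring

theorem lift_dot (g : Fin 3 → ℝ) (l : Fin 2 → ℝ) (i : Fin 2) : B.lift g l i ⬝ᵥ g = 0 := by
  rw [lift, dotProduct_comm, dot_cross_self]

/-- Cramer's rule in three dimensions. -/
theorem triple_smul_eq (x y z v : Fin 3 → ℝ) :
    (x ⬝ᵥ y ⨯₃ z) • v = (v ⬝ᵥ y ⨯₃ z) • x + (x ⬝ᵥ v ⨯₃ z) • y + (x ⬝ᵥ y ⨯₃ v) • z := by
  ext j
  fin_cases j <;> simp only [cross_apply, Matrix.vec3_dotProduct, Pi.add_apply, Pi.smul_apply,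
    smul_eq_mul, Matrix.cons_val] <;> dsimp <;> ring

theorem area_ne_zero {ε : Fin 3 → ℝ} (hε : ∀ j, ε j = 1 ∨ ε j = -1) {l : Fin 2 → ℝ}
    (hl : l ∈ B.coordDomain) : B.area (B.gammaOf ε l) l ≠ 0 := by
  intro h
  have := B.area_mul_contactForm_zero hε hl
  rw [h] at this
  exact (B.c_pos hl 0).ne (by simpa using this)

/-- Both frame vectors are tangent to the sphere, so their cross product is radial. -/
theorem frame_cross_frame {ε : Fin 3 → ℝ} (hε : ∀ j, ε j = 1 ∨ ε j = -1) {l : Fin 2 → ℝ}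
    (hl : l ∈ B.coordDomain) :
    B.frame (B.gammaOf ε l) l 0 ⨯₃ B.frame (B.gammaOf ε l) l 1 =
      B.area (B.gammaOf ε l) l • B.gammaOf ε l := by
  have h0 := B.frame_dot hε hl 0
  have h1 := B.frame_dot hε hl 1
  have hg := B.gammaOf_dot_self hε hl
  have := cross_cross_eq_smul_sub_smul (B.gammaOf ε l)
    (B.frame (B.gammaOf ε l) l 0 ⨯₃ B.frame (B.gammaOf ε l) l 1) (B.gammaOf ε l)
  have h : B.gammaOf ε l ⨯₃ (B.frame (B.gammaOf ε l) l 0 ⨯₃ B.frame (B.gammaOf ε l) l 1) = 0 := by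
    rw [cross_cross_eq_smul_sub_smul', dotProduct_comm, h1, h0]
    simp
  rw [h, hg, one_smul] at this
  rw [LinearMap.map_zero₂, eq_comm, sub_eq_zero] at this
  rw [this]
  congr 1
  rw [area, lift, ← triple_product_permutation, dotProduct_comm]

theorem exists_eq_sum_frame {ε : Fin 3 → ℝ} (hε : ∀ j, ε j = 1 ∨ ε j = -1) {l : Fin 2 → ℝ}
    (hl : l ∈ B.coordDomain) {v : Fin 3 → ℝ} (hv : v ⬝ᵥ B.gammaOf ε l = 0) :
    ∃ u : Fin 2 → ℝ, v = ∑ m, u m • B.frame (B.gammaOf ε l) l m := by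
  set g := B.gammaOf ε l
  have hA := B.area_ne_zero hε hl
  have h := triple_smul_eq (B.frame g l 0) (B.frame g l 1) g v
  have h3 : B.frame g l 0 ⬝ᵥ B.frame g l 1 ⨯₃ v = 0 := by
    rw [triple_product_permutation, triple_product_permutation, B.frame_cross_frame hε hl,
      dotProduct_smul, hv, smul_zero]
  rw [h3, zero_smul, add_zero] at h
  refine ⟨![(B.area g l)⁻¹ * (v ⬝ᵥ B.frame g l 1 ⨯₃ g),
    (B.area g l)⁻¹ * (B.frame g l 0 ⬝ᵥ v ⨯₃ g)], ?_⟩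
  rw [Fin.sum_univ_two, Matrix.cons_val_zero, Matrix.cons_val_one, Matrix.cons_val_fin_one,
    mul_smul, mul_smul, ← smul_add, ← h]
  exact (inv_smul_smul₀ hA v).symm

theorem sum_frame_cross (u : Fin 2 → ℝ) (g : Fin 3 → ℝ) (l : Fin 2 → ℝ) :
    (∑ m, u m • B.frame g l m) ⨯₃ g = ∑ m, u m • B.lift g l m := by
  simp [Fin.sum_univ_two, lift]

theorem conjugateMomentum_eq {ε : Fin 3 → ℝ} (hε : ∀ j, ε j = 1 ∨ ε j = -1) {l : Fin 2 → ℝ}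
    (hl : l ∈ B.coordDomain) (v : Fin 3 → ℝ) (i : Fin 2) :
    B.conjugateMomentum ε l v i = (1 + B.b / B.a) ^ 2 *
      B.contactForm (v ⨯₃ B.gammaOf ε l) (B.lift (B.gammaOf ε l) l i) := by
  rw [conjugateMomentum, B.coordVector_eq hl]
  have hd := B.frame_dot hε hl i
  have hg := B.gammaOf_dot_self hε hl
  rw [lift]
  set g := B.gammaOf ε l
  set e := B.frame g l i
  have hs : ∀ s : ℝ, B.compressedLagrangian g (v + s • e) = B.compressedLagrangian g v +
      s * ((1 + B.b / B.a) ^ 2 * B.contactForm (v ⨯₃ g) (e ⨯₃ g)) +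
      s ^ 2 * B.compressedLagrangian g e := by
    intro s
    have hcross : (v ⨯₃ g) ⬝ᵥ (e ⨯₃ g) = v ⬝ᵥ e := by
      rw [cross_dot_cross, hg, dotProduct_comm g e, hd]; ring
    have hc : B.contactForm (v ⨯₃ g) (e ⨯₃ g) = B.μ * B.b ^ 2 * (v ⬝ᵥ e) +
        (B.inertiaMatrix *ᵥ (v ⨯₃ g)) ⬝ᵥ (e ⨯₃ g) := by
      rw [← hcross]
      simp only [contactForm, inertiaMatrix, Matrix.mulVec_diagonal, Matrix.vec3_dotProduct,
        Fin.sum_univ_three]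
      ring
    rw [hc]
    simp only [compressedLagrangian, kineticEnergy, inertiaMatrix, Matrix.mulVec_diagonal,
      Matrix.vec3_dotProduct, Pi.add_apply, Pi.smul_apply, smul_eq_mul, cross_apply,
      Matrix.cons_val]
    ring
  simp only [hs]
  have h1 : HasDerivAt (fun s : ℝ => B.compressedLagrangian g v +
      s * ((1 + B.b / B.a) ^ 2 * B.contactForm (v ⨯₃ g) (e ⨯₃ g)) +
      s ^ 2 * B.compressedLagrangian g e)
      ((1 + B.b / B.a) ^ 2 * B.contactForm (v ⨯₃ g) (e ⨯₃ g)) 0 := by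
    refine ((((hasDerivAt_id (0 : ℝ)).mul_const _).const_add _).add
      (((hasDerivAt_id (0 : ℝ)).pow 2).mul_const _)).congr_deriv ?_
    simp
  exact h1.deriv

/-- The coordinate frame is orthogonal for the reduced kinetic energy, with coefficients `c`. -/
theorem conjugateMomentum_sum_frame {ε : Fin 3 → ℝ} (hε : ∀ j, ε j = 1 ∨ ε j = -1)
    {l : Fin 2 → ℝ} (hl : l ∈ B.coordDomain) (u : Fin 2 → ℝ) (i : Fin 2) :
    B.conjugateMomentum ε l (∑ m, u m • B.frame (B.gammaOf ε l) l m) i = B.c l i * u i := by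
  rw [B.conjugateMomentum_eq hε hl, sum_frame_cross, contactForm_sum_left]
  have h0 := B.contactForm_lift_self hε hl i
  have h1 := B.contactForm_lift_zero_one hε hl
  have h1' := h1
  rw [contactForm_comm] at h1'
  fin_cases i <;> dsimp at h0 ⊢
  · rw [h1']; linear_combination u 0 * h0
  · rw [h1]; linear_combination u 1 * h0

/-- The constant factor of the rescaled momenta. -/
noncomputable def scale : ℝ := |1 + B.b / B.a| ^ ((B.a - B.b) / B.a)

theorem scale_pos : 0 < B.scale := Real.rpow_pos_of_pos (abs_pos.2 B.ratio_ne_zero) _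

theorem prodShift_rpow_pos {l : Fin 2 → ℝ} (hl : l ∈ B.coordDomain) (s : ℝ) :
    0 < B.prodShift l ^ s := Real.rpow_pos_of_pos (B.prodShift_pos hl) _

theorem momenta_sum_frame {ε : Fin 3 → ℝ} (hε : ∀ j, ε j = 1 ∨ ε j = -1)
    {l : Fin 2 → ℝ} (hl : l ∈ B.coordDomain) (u : Fin 2 → ℝ) (i : Fin 2) :
    B.momenta ε l (∑ m, u m • B.frame (B.gammaOf ε l) l m) i =
      B.scale * B.prodShift l ^ B.expo * (B.c l i * u i) := by
  rw [momenta, B.conjugateMomentum_sum_frame hε hl, scale]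

theorem momenta_bijOn {ε : Fin 3 → ℝ} (hε : ∀ j, ε j = 1 ∨ ε j = -1)
    {l : Fin 2 → ℝ} (hl : l ∈ B.coordDomain) :
    Set.BijOn (B.momenta ε l) {v | v ⬝ᵥ B.gammaOf ε l = 0} Set.univ := by
  have hne : ∀ i, B.scale * B.prodShift l ^ B.expo * B.c l i ≠ 0 := fun i =>
    (mul_pos (mul_pos B.scale_pos (B.prodShift_rpow_pos hl _)) (B.c_pos hl i)).ne'
  refine ⟨fun _ _ => Set.mem_univ _, fun v hv w hw h => ?_, fun P _ => ?_⟩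
  · obtain ⟨u, rfl⟩ := B.exists_eq_sum_frame hε hl hv
    obtain ⟨u', rfl⟩ := B.exists_eq_sum_frame hε hl hw
    have : u = u' := by
      ext i
      have hi := congrFun h i
      rw [B.momenta_sum_frame hε hl, B.momenta_sum_frame hε hl, ← mul_assoc, ← mul_assoc] at hi
      exact mul_left_cancel₀ (hne i) hi
    rw [this]
  · refine ⟨∑ m, (P m / (B.scale * B.prodShift l ^ B.expo * B.c l m)) •
      B.frame (B.gammaOf ε l) l m, ?_, ?_⟩
    · simp [Set.mem_ofPred_eq, Fin.sum_univ_two, add_dotProduct, B.frame_dot hε hl]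
    · ext i
      rw [B.momenta_sum_frame hε hl, ← mul_assoc]
      exact mul_div_cancel₀ _ (hne i)

/-! ### The Hamiltonian vector field -/

/-- The derivative of the coefficient `c j` with respect to `λᵢ`. -/
noncomputable def cDeriv (ε : Fin 3 → ℝ) (l : Fin 2 → ℝ) (j i : Fin 2) : ℝ :=
  2 * (1 + B.b / B.a) ^ 2 *
    B.contactForm (B.liftDeriv (B.gammaOf ε l) l j i) (B.lift (B.gammaOf ε l) l j)

theorem hasDerivAt_c {ε : Fin 3 → ℝ} (hε : ∀ j, ε j = 1 ∨ ε j = -1)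
    {l : Fin 2 → ℝ} (hl : l ∈ B.coordDomain) (j i : Fin 2) :
    HasDerivAt (fun x => B.c (Function.update l i x) j) (B.cDeriv ε l j i) (l i) := by
  have h := B.hasDerivAt_lift_gammaOf (ε := ε) hl j i
  refine (((B.hasDerivAt_contactForm h h).const_mul ((1 + B.b / B.a) ^ 2)).congr_deriv ?_)
    |>.congr_of_eventuallyEq ?_
  · simp only [Function.update_eq_self, cDeriv]
    rw [contactForm_comm B (B.lift _ _ _)]
    ring
  · filter_upwards [B.update_eventually_mem_coordDomain hl i] with x hx
    exact (B.contactForm_lift_self hε hx j).symm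

/-- The derivative of the orthogonality of the frame. -/
theorem contactForm_liftDeriv_add {ε : Fin 3 → ℝ} (hε : ∀ j, ε j = 1 ∨ ε j = -1)
    {l : Fin 2 → ℝ} (hl : l ∈ B.coordDomain) (i : Fin 2) :
    B.contactForm (B.liftDeriv (B.gammaOf ε l) l 0 i) (B.lift (B.gammaOf ε l) l 1) +
      B.contactForm (B.lift (B.gammaOf ε l) l 0) (B.liftDeriv (B.gammaOf ε l) l 1 i) = 0 := by
  have h := B.hasDerivAt_contactForm (B.hasDerivAt_lift_gammaOf (ε := ε) hl 0 i)
    (B.hasDerivAt_lift_gammaOf (ε := ε) hl 1 i)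
  simp only [Function.update_eq_self] at h
  refine h.unique ((hasDerivAt_const (l i) (0 : ℝ)).congr_of_eventuallyEq ?_)
  filter_upwards [B.update_eventually_mem_coordDomain hl i] with x hx
  exact B.contactForm_lift_zero_one hε hx

theorem hasDerivAt_prodShift_rpow {l : Fin 2 → ℝ} {lt : ℝ → Fin 2 → ℝ} {u : Fin 2 → ℝ} {t : ℝ}
    (hlt : lt t = l) (hl : l ∈ B.coordDomain) (hu : HasDerivAt lt u t) (s : ℝ) :
    HasDerivAt (fun x => B.prodShift (lt x) ^ s)
      (B.prodShift l ^ s * s *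
        (u 0 / (l 0 + B.μ * B.b ^ 2) + u 1 / (l 1 + B.μ * B.b ^ 2))) t := by
  subst hlt
  rw [hasDerivAt_pi] at hu
  have h0 := (B.shift_pos hl 0).ne'
  have h1 := (B.shift_pos hl 1).ne'
  have hp := B.prodShift_pos hl
  have h := ((hu 0).add_const (B.μ * B.b ^ 2)).mul ((hu 1).add_const (B.μ * B.b ^ 2))
  have h2 := HasDerivAt.rpow_const (p := s) h (Or.inl hp.ne')
  refine h2.congr_deriv ?_
  have e : ((fun x => lt x 0 + B.μ * B.b ^ 2) * fun x => lt x 1 + B.μ * B.b ^ 2) t =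
    B.prodShift (lt t) := rfl
  rw [e, Real.rpow_sub_one hp.ne']
  rw [prodShift] at hp ⊢
  field_simp

/-- The Hamiltonian vector field, with the derivatives of the coefficients `c` left implicit in
`cDeriv`. -/
theorem canonicalField_hamiltonian {ε : Fin 3 → ℝ} (hε : ∀ j, ε j = 1 ∨ ε j = -1) {z : Phase}
    (hz : z.1 ∈ B.coordDomain) :
    canonicalField B.hamiltonian z =
      (fun i => z.2 i / (B.prodShift z.1 ^ ((B.b - B.a) / B.a) * B.c z.1 i),
       fun i => (∑ j, z.2 j ^ 2 / (B.prodShift z.1 ^ ((B.b - B.a) / B.a) * B.c z.1 j) *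
          (((B.b - B.a) / B.a) / (z.1 i + B.μ * B.b ^ 2) + B.cDeriv ε z.1 j i / B.c z.1 j)) / 2)
    := by
  have hW := (B.prodShift_rpow_pos hz ((B.b - B.a) / B.a)).ne'
  have hc := fun j => (B.c_pos hz j).ne'
  have h0 := hc 0
  have h1 := hc 1
  have hH : ∀ w : Phase, B.hamiltonian w =
      (∑ j, w.2 j ^ 2 / (B.prodShift w.1 ^ ((B.b - B.a) / B.a) * B.c w.1 j)) / 2 := fun w => by
    rw [Fin.sum_univ_two]; rfl
  refine Prod.ext (funext fun i => ?_) (funext fun i => ?_)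
  · refine HasDerivAt.deriv ?_
    simp only [hH]
    have hu := hasDerivAt_pi.1 (hasDerivAt_update z.2 i (z.2 i))
    refine ((HasDerivAt.fun_sum fun j _ =>
      ((hu j).pow 2).div_const _).div_const 2).congr_deriv ?_
    rw [Fin.sum_univ_two]
    fin_cases i <;> simp <;> field_simp
  · refine neg_eq_iff_eq_neg.2 (HasDerivAt.deriv ?_)
    simp only [hH]
    have hl : HasDerivAt (fun x => Function.update z.1 i x) (Pi.single i 1) (z.1 i) :=
      hasDerivAt_update z.1 i (z.1 i)
    have hS := B.hasDerivAt_prodShift_rpow (Function.update_eq_self i z.1) hz hl ((B.b - B.a) / B.a)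
    refine ((HasDerivAt.fun_sum fun j _ => (hasDerivAt_const (z.1 i) (z.2 j ^ 2)).div
      (hS.mul (B.hasDerivAt_c hε hz j i)) ?_).div_const 2).congr_deriv ?_
    · simpa using ⟨hW, hc j⟩
    · rw [Fin.sum_univ_two, Fin.sum_univ_two]
      simp only [Function.update_eq_self, Pi.mul_apply]
      generalize (B.b - B.a) / B.a = s at *
      fin_cases i <;> simp <;> field_simp <;> ring

/-! ### Kinematics of rotations -/

theorem hasDerivAt_of_contDiffOn_two {E : Type*} [NormedAddCommGroup E] [NormedSpace ℝ E]
    {f : ℝ → E} {J : Set ℝ} (hJ : IsOpen J) (hf : ContDiffOn ℝ 2 f J) {t : ℝ} (ht : t ∈ J) :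
    HasDerivAt f (deriv f t) t ∧ HasDerivAt (deriv f) (deriv (deriv f) t) t := by
  rw [show (2 : WithTop ℕ∞) = 1 + 1 by norm_num, contDiffOn_succ_iff_deriv_of_isOpen hJ] at hf
  obtain ⟨h1, -, h2⟩ := hf
  exact ⟨(h1.differentiableAt (hJ.mem_nhds ht)).hasDerivAt,
    ((h2.differentiableOn (by norm_num)).differentiableAt (hJ.mem_nhds ht)).hasDerivAt⟩

theorem hasDerivAt_mulVec {R : ℝ → Matrix (Fin 3) (Fin 3) ℝ} {x : ℝ → Fin 3 → ℝ} {x' : Fin 3 → ℝ}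
    {t : ℝ} (hR : ∀ i j, DifferentiableAt ℝ (fun s => R s i j) t) (hx : HasDerivAt x x' t) :
    HasDerivAt (fun s => R s *ᵥ x s) (matrixDeriv R t *ᵥ x t + R t *ᵥ x') t := by
  rw [hasDerivAt_pi] at hx ⊢
  intro i
  simp only [Matrix.mulVec, dotProduct, Pi.add_apply]
  refine (HasDerivAt.fun_sum fun j _ => (hR i j).hasDerivAt.mul (hx j)).congr_deriv ?_
  rw [← Finset.sum_add_distrib]
  rfl

theorem hasDerivAt_dotProduct {f g : ℝ → Fin 3 → ℝ} {f' g' : Fin 3 → ℝ} {t : ℝ}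
    (hf : HasDerivAt f f' t) (hg : HasDerivAt g g' t) :
    HasDerivAt (fun s => f s ⬝ᵥ g s) (f' ⬝ᵥ g t + f t ⬝ᵥ g') t := by
  rw [hasDerivAt_pi] at hf hg
  simp only [dotProduct]
  refine (HasDerivAt.fun_sum fun j _ => (hf j).mul (hg j)).congr_deriv ?_
  rw [Finset.sum_add_distrib]

theorem hasDerivAt_const_mulVec (M : Matrix (Fin 3) (Fin 3) ℝ) {x : ℝ → Fin 3 → ℝ}
    {x' : Fin 3 → ℝ} {t : ℝ} (hx : HasDerivAt x x' t) :
    HasDerivAt (fun s => M *ᵥ x s) (M *ᵥ x') t := by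
  refine (hasDerivAt_mulVec (R := fun _ => M) (fun i j => differentiableAt_const _)
    hx).congr_deriv ?_
  have : matrixDeriv (fun _ => M) t = 0 := by ext i j; simp [matrixDeriv]
  simp [this]

theorem mul_transpose_of_rotation {R : Matrix (Fin 3) (Fin 3) ℝ}
    (hR : R ∈ Matrix.specialOrthogonalGroup (Fin 3) ℝ) : R * Rᵀ = 1 :=
  (Matrix.mem_orthogonalGroup_iff (Fin 3) ℝ).1 (Matrix.mem_specialOrthogonalGroup_iff.1 hR).1

theorem transpose_mul_of_rotation {R : Matrix (Fin 3) (Fin 3) ℝ}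
    (hR : R ∈ Matrix.specialOrthogonalGroup (Fin 3) ℝ) : Rᵀ * R = 1 :=
  (Matrix.mem_orthogonalGroup_iff' (Fin 3) ℝ).1 (Matrix.mem_specialOrthogonalGroup_iff.1 hR).1

theorem transpose_mulVec_mulVec {R : Matrix (Fin 3) (Fin 3) ℝ}
    (hR : R ∈ Matrix.specialOrthogonalGroup (Fin 3) ℝ) (x : Fin 3 → ℝ) : Rᵀ *ᵥ (R *ᵥ x) = x := by
  rw [Matrix.mulVec_mulVec, transpose_mul_of_rotation hR, Matrix.one_mulVec]

theorem mulVec_transpose_mulVec {R : Matrix (Fin 3) (Fin 3) ℝ}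
    (hR : R ∈ Matrix.specialOrthogonalGroup (Fin 3) ℝ) (x : Fin 3 → ℝ) : R *ᵥ (Rᵀ *ᵥ x) = x := by
  rw [Matrix.mulVec_mulVec, mul_transpose_of_rotation hR, Matrix.one_mulVec]

theorem mulVec_dot_mulVec {R : Matrix (Fin 3) (Fin 3) ℝ}
    (hR : R ∈ Matrix.specialOrthogonalGroup (Fin 3) ℝ) (x y : Fin 3 → ℝ) :
    (R *ᵥ x) ⬝ᵥ (R *ᵥ y) = x ⬝ᵥ y := by
  rw [Matrix.dotProduct_mulVec, ← Matrix.mulVec_transpose, transpose_mulVec_mulVec hR]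

theorem mulVec_cross_mulVec {R : Matrix (Fin 3) (Fin 3) ℝ}
    (hR : R ∈ Matrix.specialOrthogonalGroup (Fin 3) ℝ) (x y : Fin 3 → ℝ) :
    (R *ᵥ x) ⨯₃ (R *ᵥ y) = R *ᵥ (x ⨯₃ y) := by
  -- The cofactor matrix of a rotation is the rotation itself.
  have hadj : R.adjugate = Rᵀ := by
    have h := Matrix.adjugate_mul R
    rw [(Matrix.mem_specialOrthogonalGroup_iff.1 hR).2, one_smul] at h
    calc R.adjugate = R.adjugate * (R * Rᵀ) := by rw [mul_transpose_of_rotation hR, mul_one]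
      _ = Rᵀ := by rw [← mul_assoc, h, one_mul]
  have h : R = R.adjugateᵀ := by rw [hadj, Matrix.transpose_transpose]
  conv_rhs => rw [h]
  ext j
  fin_cases j <;>
    simp [Matrix.adjugate_fin_three, cross_apply, Matrix.mulVec, Matrix.vec3_dotProduct] <;> ring

/-- The derivative of a curve of rotations is `R' x = R (Ω × x)`, with `Ω = Rᵀ ω`. -/
theorem matrixDeriv_mulVec {R : ℝ → Matrix (Fin 3) (Fin 3) ℝ} {J : Set ℝ} (hJ : IsOpen J)
    (hd : ∀ i j, ∀ s ∈ J, DifferentiableAt ℝ (fun s => R s i j) s)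
    (hR : ∀ s ∈ J, R s ∈ Matrix.specialOrthogonalGroup (Fin 3) ℝ) {t : ℝ} (ht : t ∈ J)
    (x : Fin 3 → ℝ) :
    matrixDeriv R t *ᵥ x = R t *ᵥ (((R t)ᵀ *ᵥ angularVelocity R t) ⨯₃ x) := by
  set M := matrixDeriv R t * (R t)ᵀ with hM
  have hskew : ∀ i j, M i j + M j i = 0 := by
    intro i j
    have h1 : HasDerivAt (fun s => (R s * (R s)ᵀ) i j) (M i j + M j i) t := by
      simp only [Matrix.mul_apply, Matrix.transpose_apply, hM, matrixDeriv, Matrix.of_apply]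
      refine (HasDerivAt.fun_sum fun m _ => (hd i m t ht).hasDerivAt.mul
        (hd j m t ht).hasDerivAt).congr_deriv ?_
      rw [← Finset.sum_add_distrib]
      exact Finset.sum_congr rfl fun m _ => by ring
    refine h1.unique ((hasDerivAt_const t ((1 : Matrix (Fin 3) (Fin 3) ℝ) i j)).congr_of_eventuallyEq
      ?_)
    filter_upwards [hJ.mem_nhds ht] with s hs
    rw [mul_transpose_of_rotation (hR s hs)]
  have hω : ∀ y, M *ᵥ y = angularVelocity R t ⨯₃ y := by
    intro y
    have h00 := hskew 0 0
    have h11 := hskew 1 1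
    have h22 := hskew 2 2
    have h01 := hskew 0 1
    have h02 := hskew 0 2
    have h12 := hskew 1 2
    ext j
    fin_cases j <;> simp only [angularVelocity, ← hM, cross_apply, Matrix.mulVec,
      Matrix.vec3_dotProduct, Matrix.cons_val] <;> dsimp
    · linear_combination y 0 / 2 * h00 + y 1 * h01
    · linear_combination y 1 / 2 * h11 + y 2 * h12
    · linear_combination y 2 / 2 * h22 + y 0 * h02
  have h := hω (R t *ᵥ x)
  rw [hM, ← Matrix.mulVec_mulVec, transpose_mulVec_mulVec (hR t ht)] at h
  rw [h, ← mulVec_cross_mulVec (hR t ht), mulVec_transpose_mulVec (hR t ht)]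

/-! ### The equations of motion in the body frame -/

variable {B}

section Motion

variable {q : ℝ → Fin 3 → ℝ} {R : ℝ → Matrix (Fin 3) (Fin 3) ℝ} {J : Set ℝ}

theorem IsRollingMotion.contDiffOn_poisson (h : B.IsRollingMotion q R J) :
    ContDiffOn ℝ 2 (B.poisson q R) J := by
  rw [contDiffOn_pi]
  intro i
  have hq := contDiffOn_pi.1 h.contDiffOn_q
  simp only [poisson, Matrix.mulVec, Matrix.vec3_dotProduct, Matrix.transpose_apply, Pi.smul_apply,
    smul_eq_mul]
  have hR := h.contDiffOn_R
  exact (((hR 0 i).mul (contDiffOn_const.mul (hq 0))).add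
    ((hR 1 i).mul (contDiffOn_const.mul (hq 1)))).add
    ((hR 2 i).mul (contDiffOn_const.mul (hq 2)))

theorem IsRollingMotion.eq_smul_poisson (h : B.IsRollingMotion q R J) {t : ℝ} (ht : t ∈ J) :
    q t = B.a • (R t *ᵥ B.poisson q R t) := by
  rw [poisson, mulVec_transpose_mulVec (h.mem_rotations t ht), smul_inv_smul₀ B.a_pos.ne']

theorem IsRollingMotion.poisson_dot_self (h : B.IsRollingMotion q R J) {t : ℝ} (ht : t ∈ J) :
    B.poisson q R t ⬝ᵥ B.poisson q R t = 1 := by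
  have h1 := h.mem_sphere t ht
  rw [h.eq_smul_poisson ht, smul_dotProduct, dotProduct_smul,
    mulVec_dot_mulVec (h.mem_rotations t ht)] at h1
  have ha := B.a_pos.ne'
  apply mul_left_cancel₀ (pow_ne_zero 2 ha)
  rw [smul_eq_mul, smul_eq_mul] at h1
  linear_combination h1

theorem IsRollingMotion.deriv_poisson_dot (h : B.IsRollingMotion q R J) (hJ : IsOpen J) {t : ℝ}
    (ht : t ∈ J) : deriv (B.poisson q R) t ⬝ᵥ B.poisson q R t = 0 := by
  have hγ := (hasDerivAt_of_contDiffOn_two hJ h.contDiffOn_poisson ht).1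
  have h1 := (hasDerivAt_dotProduct hγ hγ).unique
    ((hasDerivAt_const t (1 : ℝ)).congr_of_eventuallyEq (by
      filter_upwards [hJ.mem_nhds ht] with s hs
      exact h.poisson_dot_self hs))
  rw [dotProduct_comm (B.poisson q R t)] at h1
  linarith

theorem IsRollingMotion.differentiableAt_R (h : B.IsRollingMotion q R J) (hJ : IsOpen J)
    (i j : Fin 3) (t : ℝ) (ht : t ∈ J) : DifferentiableAt ℝ (fun s => R s i j) t :=
  (hasDerivAt_of_contDiffOn_two hJ (h.contDiffOn_R i j) ht).1.differentiableAt

/-- The velocities are the horizontal lift of the velocity of the Poisson vector. -/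
theorem IsRollingMotion.horizontal (h : B.IsRollingMotion q R J) (hJ : IsOpen J) {t : ℝ}
    (ht : t ∈ J) :
    (R t)ᵀ *ᵥ angularVelocity R t =
      (1 + B.b / B.a) • (deriv (B.poisson q R) t ⨯₃ B.poisson q R t) ∧
    deriv q t = -B.b • (R t *ᵥ deriv (B.poisson q R) t) := by
  have hrot := h.mem_rotations t ht
  have hγ := (hasDerivAt_of_contDiffOn_two hJ h.contDiffOn_poisson ht).1
  have hg1 := h.poisson_dot_self ht
  have hq := h.eq_smul_poisson ht
  set γ := B.poisson q R
  set Ω := (R t)ᵀ *ᵥ angularVelocity R t with hΩ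
  have hω : angularVelocity R t = R t *ᵥ Ω := by rw [hΩ, mulVec_transpose_mulVec hrot]
  have hq' : deriv q t = B.a • (R t *ᵥ (Ω ⨯₃ γ t + deriv γ t)) := by
    have h1 := (hasDerivAt_mulVec (fun i j => h.differentiableAt_R hJ i j t ht) hγ).const_smul B.a
    rw [matrixDeriv_mulVec hJ (h.differentiableAt_R hJ) h.mem_rotations ht,
      ← Matrix.mulVec_add] at h1
    refine (h1.congr_of_eventuallyEq ?_).deriv
    filter_upwards [hJ.mem_nhds ht] with s hs
    exact h.eq_smul_poisson hs
  obtain ⟨hc, hd⟩ := h.constraints t ht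
  rw [hq', hq, hω, LinearMap.map_smul, mulVec_cross_mulVec hrot, ← Matrix.mulVec_smul,
    ← Matrix.mulVec_smul, ← Matrix.mulVec_smul, ← Matrix.mulVec_smul] at hc
  have hc' := congrArg (fun x => (R t)ᵀ *ᵥ x) hc
  simp only [transpose_mulVec_mulVec hrot] at hc'
  rw [hω, hq, dotProduct_smul, mulVec_dot_mulVec hrot, smul_eq_mul] at hd
  have hd' : Ω ⬝ᵥ γ t = 0 := (mul_eq_zero.1 hd).resolve_left B.a_pos.ne'
  have ha := B.a_pos.ne'
  have hcross : Ω ⨯₃ γ t = -(1 + B.b / B.a) • deriv γ t := by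
    ext j
    have := congrFun hc' j
    simp only [Pi.smul_apply, Pi.add_apply, smul_eq_mul] at this ⊢
    field_simp at this ⊢
    linear_combination this
  constructor
  · have h2 := cross_cross_eq_smul_sub_smul Ω (γ t) (γ t)
    rw [hd', hg1, hcross] at h2
    simp only [LinearMap.map_smul, LinearMap.smul_apply, zero_smul, one_smul, zero_sub] at h2
    rw [← neg_inj, ← h2, neg_smul]
  · rw [hq', hcross, ← Matrix.mulVec_smul, ← Matrix.mulVec_smul]
    congr 1
    ext j
    simp only [Pi.smul_apply, Pi.add_apply, smul_eq_mul]
    field_simp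
    ring

/-- The equation of motion in the body frame: d'Alembert's principle, tested on the virtual
rotations `R n` about the axes orthogonal to `γ`. -/
theorem IsRollingMotion.body_equation (h : B.IsRollingMotion q R J) (hJ : IsOpen J) {t : ℝ}
    (ht : t ∈ J) {n : Fin 3 → ℝ} (hn : n ⬝ᵥ B.poisson q R t = 0) :
    B.contactForm (deriv (deriv (B.poisson q R)) t ⨯₃ B.poisson q R t) n +
      (1 + B.b / B.a) * (((deriv (B.poisson q R) t ⨯₃ B.poisson q R t) ⨯₃
        (B.inertiaMatrix *ᵥ (deriv (B.poisson q R) t ⨯₃ B.poisson q R t))) ⬝ᵥ n) = 0 := by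
  have hrot := h.mem_rotations t ht
  obtain ⟨hγ, hγ'⟩ := hasDerivAt_of_contDiffOn_two hJ h.contDiffOn_poisson ht
  have hq := h.eq_smul_poisson ht
  have hk := B.ratio_ne_zero
  have ha := B.a_pos.ne'
  have hRd := fun i j => h.differentiableAt_R hJ i j t ht
  have hRm := matrixDeriv_mulVec hJ (h.differentiableAt_R hJ) h.mem_rotations ht
  have hhor := fun s (hs : s ∈ J) => h.horizontal hJ hs
  rw [(hhor t ht).1] at hRm
  set γ := B.poisson q R
  set N := deriv γ t ⨯₃ γ t with hN
  have hNd : HasDerivAt (fun s => deriv γ s ⨯₃ γ s) (deriv (deriv γ) t ⨯₃ γ t) t := by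
    refine (hasDerivAt_cross hγ' hγ).congr_deriv ?_
    rw [cross_self, add_zero]
  -- the angular momentum
  have hℓ : deriv (B.angularMomentum R) t = R t *ᵥ
      (((1 + B.b / B.a) • N) ⨯₃ (B.inertiaMatrix *ᵥ ((1 + B.b / B.a) • N)) +
        B.inertiaMatrix *ᵥ ((1 + B.b / B.a) • (deriv (deriv γ) t ⨯₃ γ t))) := by
    have h1 := hasDerivAt_mulVec hRd
      (hasDerivAt_const_mulVec B.inertiaMatrix (hNd.fun_const_smul (1 + B.b / B.a)))
    rw [hRm, ← Matrix.mulVec_add] at h1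
    refine (h1.congr_of_eventuallyEq ?_).deriv
    filter_upwards [hJ.mem_nhds ht] with s hs
    rw [angularMomentum, (hhor s hs).1]
  -- the acceleration of the centre
  have hq'' : deriv (deriv fun s => B.center (q s)) t = (1 + B.b / B.a) • -B.b •
      (R t *ᵥ (((1 + B.b / B.a) • N) ⨯₃ deriv γ t + deriv (deriv γ) t)) := by
    have h1 := ((hasDerivAt_mulVec hRd hγ').fun_const_smul (-B.b)).fun_const_smul (1 + B.b / B.a)
    rw [hRm, ← Matrix.mulVec_add] at h1
    refine (h1.congr_of_eventuallyEq ?_).deriv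
    filter_upwards [hJ.mem_nhds ht] with s hs
    rw [← (hhor s hs).2]
    exact ((hasDerivAt_of_contDiffOn_two hJ h.contDiffOn_q hs).1.const_smul (1 + B.b / B.a)).deriv
  have hδ : B.Admissible (q t) ((1 + B.b / B.a)⁻¹ • (B.b / B.a) • ((R t *ᵥ n) ⨯₃ q t))
      (R t *ᵥ n) := by
    refine ⟨smul_inv_smul₀ hk _, ?_⟩
    rw [hq, dotProduct_smul, mulVec_dot_mulVec hrot, hn, smul_zero]
  have hdA := h.dAlembert t ht _ _ hδ
  rw [hq'', hℓ, center, smul_inv_smul₀ hk, hq, (crossProduct (R t *ᵥ n)).map_smul, mulVec_cross_mulVec hrot,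
    mulVec_dot_mulVec hrot] at hdA
  simp only [smul_dotProduct, dotProduct_smul, mulVec_dot_mulVec hrot, smul_eq_mul] at hdA
  -- `N × γ'` is parallel to `γ`
  have hpar : (((1 + B.b / B.a) • N) ⨯₃ deriv γ t) ⬝ᵥ (n ⨯₃ γ t) = 0 := by
    rw [cross_dot_cross, h.deriv_poisson_dot hJ ht, smul_dotProduct, smul_dotProduct, hN,
      dotProduct_comm _ (γ t), dot_cross_self]
    simp
  rw [add_dotProduct, hpar, zero_add] at hdA
  apply mul_left_cancel₀ hk
  rw [mul_zero, ← hdA]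
  simp only [contactForm, inertiaMatrix, Matrix.mulVec_diagonal, Matrix.vec3_dotProduct,
    Fin.sum_univ_three, cross_apply, Pi.smul_apply, Pi.add_apply, smul_eq_mul, Matrix.cons_val]
  field_simp
  ring

end Motion

/-! ### The reduced equations -/

/-- The chain rule `γ' = ∑ λₘ' ∂γ/∂λₘ`, obtained by differentiating the squares of the
components of `γ`. -/
theorem deriv_eq_sum_frame {ε : Fin 3 → ℝ} (hε : ∀ j, ε j = 1 ∨ ε j = -1)
    {g : ℝ → Fin 3 → ℝ} {l : ℝ → Fin 2 → ℝ} {g' : Fin 3 → ℝ} {u : Fin 2 → ℝ} {t : ℝ}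
    (hlt : ∀ᶠ s in nhds t, l s ∈ B.coordDomain ∧ B.gammaOf ε (l s) = g s)
    (hl : HasDerivAt l u t) (hg : HasDerivAt g g' t) :
    g' = ∑ m, u m • B.frame (g t) (l t) m := by
  obtain ⟨hm, hgt⟩ := hlt.self_of_nhds
  rw [hasDerivAt_pi] at hl hg
  ext j
  have hne : g t j ≠ 0 := hgt ▸ B.gammaOf_ne_zero hε hm j
  obtain ⟨D, hD⟩ : ∃ D, ∀ x, B.gammaSq x j = (B.inertia j - x 0) * (B.inertia j - x 1) / D := by
    fin_cases j <;> exact ⟨_, fun x => rfl⟩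
  have h1 := (hg j).pow 2
  have h2 : HasDerivAt (fun s => g s j ^ 2)
      ((-u 0 * (B.inertia j - l t 1) + (B.inertia j - l t 0) * -u 1) / D) t := by
    refine ((((hl 0).const_sub _).mul ((hl 1).const_sub _)).div_const D).congr_of_eventuallyEq ?_
    filter_upwards [hlt] with s hs
    rw [← hs.2, B.gammaOf_sq hε hs.1, hD]
    rfl
  have h3 := h1.unique h2
  have h4 : g t j ^ 2 = (B.inertia j - l t 0) * (B.inertia j - l t 1) / D := by
    rw [← hgt, B.gammaOf_sq hε hm, hD]
  have n0 := B.coordDomain_ne hm 0 j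
  have n1 := B.coordDomain_ne hm 1 j
  have hD0 : D ≠ 0 := by
    rintro rfl
    rw [div_zero] at h4
    exact hne (pow_eq_zero_iff two_ne_zero |>.1 h4)
  rw [eq_div_iff hD0] at h3 h4
  apply mul_left_cancel₀ (mul_ne_zero (mul_ne_zero two_ne_zero hne) hD0)
  simp only [Fin.sum_univ_two, Pi.add_apply, Pi.smul_apply, smul_eq_mul, frame]
  have h5 : 2 * g t j * D * (u 0 * (g t j / (2 * (l t 0 - B.inertia j))) +
      u 1 * (g t j / (2 * (l t 1 - B.inertia j)))) =
      (g t j ^ 2 * D) * (u 0 / (l t 0 - B.inertia j) + u 1 / (l t 1 - B.inertia j)) := by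
    field_simp
  rw [h5, h4]
  simp only [Nat.cast_ofNat, Nat.add_one_sub_one, pow_one] at h3
  field_simp
  linear_combination (l t 0 - B.inertia j) * (l t 1 - B.inertia j) * h3

section Reduced

variable {ε : Fin 3 → ℝ} {q : ℝ → Fin 3 → ℝ} {R : ℝ → Matrix (Fin 3) (Fin 3) ℝ} {z : ℝ → Phase}
  {J : Set ℝ}

/-- The coordinates are roots of a quadratic polynomial with coefficients polynomial in `γ`. -/
theorem IsReducedMotion.exists_hasDerivAt (hε : ∀ j, ε j = 1 ∨ ε j = -1)
    (h : B.IsReducedMotion ε q R z J) (hJ : IsOpen J) {t : ℝ} (ht : t ∈ J) :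
    ∃ u, HasDerivAt (fun s => (z s).1) u t := by
  obtain ⟨hm, hz⟩ := h
  have hγ := fun j => (hasDerivAt_pi.1
    (hasDerivAt_of_contDiffOn_two hJ hm.contDiffOn_poisson ht).1 j).differentiableAt
  have g0 := hγ 0
  have g1 := hγ 1
  have g2 := hγ 2
  set γ := B.poisson q R
  set S : ℝ → ℝ := fun s => (B.inertia 1 + B.inertia 2) * γ s 0 ^ 2
      + (B.inertia 0 + B.inertia 2) * γ s 1 ^ 2 + (B.inertia 0 + B.inertia 1) * γ s 2 ^ 2 with hS
  set Q : ℝ → ℝ := fun s => B.inertia 1 * B.inertia 2 * γ s 0 ^ 2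
      + B.inertia 0 * B.inertia 2 * γ s 1 ^ 2 + B.inertia 0 * B.inertia 1 * γ s 2 ^ 2 with hQ
  have hSd : DifferentiableAt ℝ S t := by fun_prop
  have hQd : DifferentiableAt ℝ Q t := by fun_prop
  have hSe : ∀ s ∈ J, S s = (z s).1 0 + (z s).1 1 := fun s hs => by
    simp only [hS, ← (hz s hs).2.1, (B.gammaOf_moments hε (hz s hs).1).2.1]
  have hQe : ∀ s ∈ J, Q s = (z s).1 0 * (z s).1 1 := fun s hs => by
    simp only [hQ, ← (hz s hs).2.1, (B.gammaOf_moments hε (hz s hs).1).2.2]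
  have hlt : ∀ s ∈ J, 0 < (z s).1 1 - (z s).1 0 := fun s hs => by
    obtain ⟨-, h2, h3, -⟩ := (hz s hs).1
    linarith
  have hdisc : ∀ s ∈ J, S s ^ 2 - 4 * Q s = ((z s).1 1 - (z s).1 0) ^ 2 := fun s hs => by
    rw [hSe s hs, hQe s hs]; ring
  have hsq : DifferentiableAt ℝ (fun s => Real.sqrt (S s ^ 2 - 4 * Q s)) t := by
    refine DifferentiableAt.sqrt ((hSd.pow 2).sub (hQd.const_mul 4)) ?_
    have := hlt t ht
    rw [hdisc t ht]
    positivity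
  refine ⟨_, (differentiableAt_pi.2 fun i => ?_).hasDerivAt⟩
  have hroot : ∀ s ∈ J, Real.sqrt (S s ^ 2 - 4 * Q s) = (z s).1 1 - (z s).1 0 := fun s hs => by
    rw [hdisc s hs, Real.sqrt_sq (hlt s hs).le]
  fin_cases i
  · refine ((hSd.sub hsq).div_const 2).congr_of_eventuallyEq ?_
    filter_upwards [hJ.mem_nhds ht] with s hs
    simp only [Pi.sub_apply]
    rw [hroot s hs, hSe s hs]
    dsimp
    ring
  · refine ((hSd.add hsq).div_const 2).congr_of_eventuallyEq ?_
    filter_upwards [hJ.mem_nhds ht] with s hs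
    simp only [Pi.add_apply]
    rw [hroot s hs, hSe s hs]
    dsimp
    ring

end Reduced

/-- The lifts are not a coordinate frame: the mixed derivatives differ by the curvature term
`2 ∂γ/∂λ₁ × ∂γ/∂λ₂`. -/
theorem liftDeriv_zero_one (hε : ∀ j, ε j = 1 ∨ ε j = -1) {l : Fin 2 → ℝ}
    (hl : l ∈ B.coordDomain) :
    B.liftDeriv (B.gammaOf ε l) l 0 1 = B.liftDeriv (B.gammaOf ε l) l 1 0 +
      (2 * B.area (B.gammaOf ε l) l) • B.gammaOf ε l := by
  rw [liftDeriv, liftDeriv, frameDeriv_comm, ← cross_anticomm (B.frame _ l 0),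
    B.frame_cross_frame hε hl]
  module

theorem lift_zero_dot_frame_one (g : Fin 3 → ℝ) (l : Fin 2 → ℝ) :
    B.lift g l 0 ⬝ᵥ B.frame g l 1 = -B.area g l := by
  simp only [area, lift, cross_apply, Matrix.vec3_dotProduct, Matrix.cons_val]
  ring

theorem lift_dot_frame_self (g : Fin 3 → ℝ) (l : Fin 2 → ℝ) (i : Fin 2) :
    B.lift g l i ⬝ᵥ B.frame g l i = 0 := by
  rw [lift, dotProduct_comm, dot_self_cross]

/-- The gyroscopic work of a horizontal motion along the coordinate directions. -/
theorem gyroscopic_dot {g : Fin 3 → ℝ} (l : Fin 2 → ℝ) {N : Fin 3 → ℝ}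
    (hN : N ⬝ᵥ g = 0) (i : Fin 2) :
    (N ⨯₃ (B.inertiaMatrix *ᵥ N)) ⬝ᵥ B.lift g l i =
      (N ⬝ᵥ B.frame g l i) * B.contactForm N g := by
  rw [lift, cross_dot_cross, hN, zero_mul, sub_zero]
  congr 1
  have : B.contactForm N g = (B.inertiaMatrix *ᵥ N) ⬝ᵥ g +
      B.μ * B.b ^ 2 * (N ⬝ᵥ g) := by
    simp only [contactForm, inertiaMatrix, Matrix.mulVec_diagonal, Matrix.vec3_dotProduct,
      Fin.sum_univ_three]
    ring
  rw [this, hN, mul_zero, add_zero]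

/-- The equations for the conjugate momenta: the derivative of `pᵢ = cᵢ λᵢ'` is the derivative of
the Lagrangian `½ ∑ⱼ cⱼ (λⱼ')²` plus the gyroscopic force, which has the Chaplygin form with
multiplier `[(λ₁ + μb²)(λ₂ + μb²)] ^ expo`. -/
theorem momentum_rate (hε : ∀ j, ε j = 1 ∨ ε j = -1) {l : Fin 2 → ℝ} (hl : l ∈ B.coordDomain)
    {u : Fin 2 → ℝ} {N N' : Fin 3 → ℝ} (hN : N = ∑ m, u m • B.lift (B.gammaOf ε l) l m) (i : Fin 2)
    (hbody : B.contactForm N' (B.lift (B.gammaOf ε l) l i) + (1 + B.b / B.a) *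
      ((N ⨯₃ (B.inertiaMatrix *ᵥ N)) ⬝ᵥ B.lift (B.gammaOf ε l) l i) = 0) :
    (1 + B.b / B.a) ^ 2 * (B.contactForm N' (B.lift (B.gammaOf ε l) l i) +
      B.contactForm N (∑ m, u m • B.liftDeriv (B.gammaOf ε l) l i m)) =
      (∑ j, u j ^ 2 * B.cDeriv ε l j i) / 2 +
      B.expo * ((∑ j, B.c l j * u j ^ 2) / (l i + B.μ * B.b ^ 2) -
        (u 0 / (l 0 + B.μ * B.b ^ 2) + u 1 / (l 1 + B.μ * B.b ^ 2)) * (B.c l i * u i)) := by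
  have hNγ : N ⬝ᵥ B.gammaOf ε l = 0 := by
    simp [hN, Fin.sum_univ_two, lift_dot]
  have he : B.expo = ((1 + B.b / B.a) - 2) / 2 := by
    have := B.a_pos.ne'
    rw [expo]; field_simp; ring
  rw [gyroscopic_dot l hNγ] at hbody
  have a0 := B.area_mul_contactForm_zero hε hl
  have a1 := B.area_mul_contactForm_one hε hl
  have o0 := B.contactForm_liftDeriv_add hε hl 0
  have o1 := B.contactForm_liftDeriv_add hε hl 1
  have s0 := (B.shift_pos hl 0).ne'
  have s1 := (B.shift_pos hl 1).ne'
  have f01 : B.lift (B.gammaOf ε l) l 0 ⬝ᵥ B.frame (B.gammaOf ε l) l 1 =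
    -B.area (B.gammaOf ε l) l := lift_zero_dot_frame_one _ _
  have f10 : B.lift (B.gammaOf ε l) l 1 ⬝ᵥ B.frame (B.gammaOf ε l) l 0 =
    B.area (B.gammaOf ε l) l := by rw [dotProduct_comm, area]
  have f00 := lift_dot_frame_self (B := B) (B.gammaOf ε l) l 0
  have f11 := lift_dot_frame_self (B := B) (B.gammaOf ε l) l 1
  have hD := liftDeriv_zero_one hε hl
  have d : ∀ y, B.contactForm (B.liftDeriv (B.gammaOf ε l) l 0 1) y =
      B.contactForm (B.liftDeriv (B.gammaOf ε l) l 1 0) y +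
      2 * B.area (B.gammaOf ε l) l * B.contactForm y (B.gammaOf ε l) := by
    intro y
    rw [hD]
    simp only [contactForm, Fin.sum_univ_three, Pi.add_apply, Pi.smul_apply, smul_eq_mul]
    ring
  have hNe : ∀ e : Fin 3 → ℝ, N ⬝ᵥ e = u 0 * (B.lift (B.gammaOf ε l) l 0 ⬝ᵥ e) +
      u 1 * (B.lift (B.gammaOf ε l) l 1 ⬝ᵥ e) := fun e => by
    simp [hN, Fin.sum_univ_two, add_dotProduct]
  rw [hNe] at hbody
  rw [contactForm_sum_right, he]
  rw [hN] at hbody ⊢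
  simp only [contactForm_sum_left] at hbody ⊢
  simp only [cDeriv, Fin.sum_univ_two] at hbody ⊢
  simp only [contactForm_comm B (B.lift _ _ _) (B.liftDeriv _ _ _ _)] at o0 o1 ⊢
  have d0 := d (B.lift (B.gammaOf ε l) l 0)
  have d1 := d (B.lift (B.gammaOf ε l) l 1)
  generalize 1 + B.b / B.a = k at *
  have a0' : 2 * k ^ 2 * (B.area (B.gammaOf ε l) l *
      B.contactForm (B.lift (B.gammaOf ε l) l 0) (B.gammaOf ε l)) =
      B.c l 0 / (l 1 + B.μ * B.b ^ 2) := by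
    rw [eq_div_iff s1, ← a0]; ring
  have a1' : 2 * k ^ 2 * (B.area (B.gammaOf ε l) l *
      B.contactForm (B.lift (B.gammaOf ε l) l 1) (B.gammaOf ε l)) =
      -B.c l 1 / (l 0 + B.μ * B.b ^ 2) := by
    rw [eq_div_iff s0, ← a1]; ring
  fin_cases i
  · dsimp at hbody ⊢
    rw [f00, f10] at hbody
    linear_combination k ^ 2 * hbody + k ^ 2 * u 0 * u 1 * (o0 + d0) + k ^ 2 * u 1 ^ 2 * d1 -
      (k - 2) / 2 * u 0 * u 1 * a0' - (k - 2) / 2 * u 1 ^ 2 * a1'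
  · dsimp at hbody ⊢
    rw [f01, f11] at hbody
    linear_combination k ^ 2 * hbody - k ^ 2 * u 0 ^ 2 * d0 + k ^ 2 * u 0 * u 1 * (o1 - d1) +
      (k - 2) / 2 * u 0 ^ 2 * a0' + (k - 2) / 2 * u 0 * u 1 * a1'

variable (B) in
/-- The multiplier `F ^ ((b - a)/(2a))` in coordinates. -/
theorem F_rpow {ε : Fin 3 → ℝ} (hε : ∀ j, ε j = 1 ∨ ε j = -1) {l : Fin 2 → ℝ}
    (hl : l ∈ B.coordDomain) : B.F (B.gammaOf ε l) ^ ((B.b - B.a) / (2 * B.a)) =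
      B.scale⁻¹ * B.prodShift l ^ B.expo := by
  have ha := B.a_pos.ne'
  rw [B.F_gammaOf hε hl, mul_assoc, ← prodShift, expo,
    Real.mul_rpow (sq_nonneg _) (B.prodShift_pos hl).le]
  congr 1
  rw [scale, ← Real.rpow_neg (abs_nonneg _), ← sq_abs, ← Real.rpow_natCast,
    ← Real.rpow_mul (abs_nonneg _)]
  congr 1
  push_cast
  field_simp
  ring

theorem prodShift_rpow_two_expo {l : Fin 2 → ℝ} (hl : l ∈ B.coordDomain) :
    B.prodShift l ^ ((B.b - B.a) / B.a) = (B.prodShift l ^ B.expo) ^ 2 := by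
  have ha := B.a_pos.ne'
  rw [← Real.rpow_natCast, ← Real.rpow_mul (B.prodShift_pos hl).le, expo]
  congr 1
  push_cast
  field_simp

/-- The projection of a motion is an integral curve of `F ^ ((b - a)/(2a)) X_H`. -/
theorem IsReducedMotion.hasDerivAt {ε : Fin 3 → ℝ} (hε : ∀ j, ε j = 1 ∨ ε j = -1)
    {q : ℝ → Fin 3 → ℝ} {R : ℝ → Matrix (Fin 3) (Fin 3) ℝ} {z : ℝ → Phase} {J : Set ℝ}
    (h : B.IsReducedMotion ε q R z J) (hJ : IsOpen J) {t : ℝ} (ht : t ∈ J) :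
    HasDerivAt z (B.F (B.gammaOf ε (z t).1) ^ ((B.b - B.a) / (2 * B.a)) •
      canonicalField B.hamiltonian (z t)) t := by
  obtain ⟨u, hu⟩ := h.exists_hasDerivAt hε hJ ht
  obtain ⟨hm, hz⟩ := h
  obtain ⟨hγ, hγ'⟩ := hasDerivAt_of_contDiffOn_two hJ hm.contDiffOn_poisson ht
  have hbody := fun n hn => hm.body_equation hJ ht (n := n) hn
  have hev : ∀ᶠ s in nhds t, (z s).1 ∈ B.coordDomain ∧ B.gammaOf ε (z s).1 = B.poisson q R s := by
    filter_upwards [hJ.mem_nhds ht] with s hs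
    exact ⟨(hz s hs).1, (hz s hs).2.1⟩
  obtain ⟨hl, hgt, hP⟩ := hz t ht
  have hv := deriv_eq_sum_frame hε hev hu hγ
  set γ := B.poisson q R
  have hN : deriv γ t ⨯₃ γ t = ∑ m, u m • B.lift (B.gammaOf ε (z t).1) (z t).1 m := by
    rw [hv, sum_frame_cross, hgt]
  have hNd : HasDerivAt (fun s => deriv γ s ⨯₃ γ s) (deriv (deriv γ) t ⨯₃ γ t) t := by
    refine (hasDerivAt_cross hγ' hγ).congr_deriv ?_
    rw [cross_self, add_zero]
  have hPt : ∀ i, (z t).2 i = B.scale * B.prodShift (z t).1 ^ B.expo * (B.c (z t).1 i * u i) := by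
    intro i
    rw [hP, hv, ← hgt, B.momenta_sum_frame hε hl]
  have hW := (B.prodShift_rpow_pos hl B.expo).ne'
  have hs := B.scale_pos.ne'
  have hc := fun j => (B.c_pos hl j).ne'
  have hc0 := hc 0
  have hc1 := hc 1
  rw [B.canonicalField_hamiltonian hε hl, B.F_rpow hε hl, prodShift_rpow_two_expo hl]
  refine HasDerivAt.prodMk (hu.congr_deriv (funext fun i => ?_)) (hasDerivAt_pi.2 fun i => ?_)
  · simp only [Pi.smul_apply, smul_eq_mul, hPt]
    have := hc i
    field_simp
  · have hpd := (B.hasDerivAt_contactForm hNd (B.hasDerivAt_lift (g := γ) hl hu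
      (hv ▸ hγ) i)).const_mul ((1 + B.b / B.a) ^ 2)
    have hWd := (B.hasDerivAt_prodShift_rpow rfl hl hu B.expo).const_mul B.scale
    have hrate := momentum_rate hε hl hN i
      (hbody (B.lift (B.gammaOf ε (z t).1) (z t).1 i) (by rw [← hgt]; exact B.lift_dot _ _ _))
    have hd := hWd.mul hpd
    rw [← hgt] at hd hrate
    rw [hrate] at hd
    have hpi : (1 + B.b / B.a) ^ 2 * B.contactForm (deriv γ t ⨯₃ B.gammaOf ε (z t).1)
        (B.lift (B.gammaOf ε (z t).1) (z t).1 i) = B.c (z t).1 i * u i := by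
      rw [← B.conjugateMomentum_eq hε hl, hv, ← hgt, B.conjugateMomentum_sum_frame hε hl]
    refine (hd.congr_of_eventuallyEq ?_).congr_deriv ?_
    · filter_upwards [hJ.mem_nhds ht] with s hs
      rw [(hz s hs).2.2, momenta, B.conjugateMomentum_eq hε (hz s hs).1, (hz s hs).2.1]
      rfl
    · rw [hpi]
      have he : (B.b - B.a) / B.a = 2 * B.expo := by
        have := B.a_pos.ne'
        rw [expo]; field_simp
      have h0 := (B.shift_pos hl 0).ne'
      have h1 := (B.shift_pos hl 1).ne'
      have hi := (B.shift_pos hl i).ne'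
      simp only [Pi.smul_apply, smul_eq_mul, hPt, Fin.sum_univ_two, he]
      field_simp
      ring

/-! ### Existence of motions -/

theorem eq_of_cross_eq {v w : Fin 3 → ℝ} (h : ∀ x, v ⨯₃ x = w ⨯₃ x) : v = w := by
  have h1 := h ![1, 0, 0]
  have h2 := h ![0, 1, 0]
  simp only [cross_apply, Matrix.cons_val] at h1 h2
  have e1 := congrFun h1 1
  have e2 := congrFun h1 2
  have e3 := congrFun h2 2
  simp at e1 e2 e3
  ext j
  fin_cases j <;> assumption

/-- A solution of the body-frame equations yields a motion of the ball. -/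
theorem isRollingMotion_of_body_equation {R : ℝ → Matrix (Fin 3) (Fin 3) ℝ}
    {γ Ω Ω' : ℝ → Fin 3 → ℝ} {J : Set ℝ} (hJ : IsOpen J)
    (hR : ∀ t ∈ J, R t ∈ Matrix.specialOrthogonalGroup (Fin 3) ℝ)
    (hRC : ∀ i j, ContDiffOn ℝ 2 (fun t => R t i j) J) (hγC : ContDiffOn ℝ 2 γ J)
    (hRd : ∀ t ∈ J, ∀ x, matrixDeriv R t *ᵥ x = R t *ᵥ (Ω t ⨯₃ x))
    (hγ : ∀ t ∈ J, HasDerivAt γ ((1 + B.b / B.a)⁻¹ • (γ t ⨯₃ Ω t)) t)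
    (hΩ : ∀ t ∈ J, HasDerivAt Ω (Ω' t) t)
    (hγ1 : ∀ t ∈ J, γ t ⬝ᵥ γ t = 1) (hΩγ : ∀ t ∈ J, Ω t ⬝ᵥ γ t = 0)
    (hbody : ∀ t ∈ J, ∀ n, n ⬝ᵥ γ t = 0 →
      B.contactForm (Ω' t) n + (Ω t ⨯₃ (B.inertiaMatrix *ᵥ Ω t)) ⬝ᵥ n = 0) :
    B.IsRollingMotion (fun t => B.a • (R t *ᵥ γ t)) R J := by
  have hk := B.ratio_ne_zero
  have ha := B.a_pos.ne'
  have hab := B.add_ne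
  have hRdiff : ∀ i j, ∀ s ∈ J, DifferentiableAt ℝ (fun s => R s i j) s := fun i j s hs =>
    (hasDerivAt_of_contDiffOn_two hJ (hRC i j) hs).1.differentiableAt
  have hω : ∀ t ∈ J, (R t)ᵀ *ᵥ angularVelocity R t = Ω t := fun t ht => by
    refine eq_of_cross_eq fun x => ?_
    have h := (matrixDeriv_mulVec hJ hRdiff hR ht x).symm.trans (hRd t ht x)
    rw [← transpose_mulVec_mulVec (hR t ht) (((R t)ᵀ *ᵥ angularVelocity R t) ⨯₃ x), h,
      transpose_mulVec_mulVec (hR t ht)]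
  have hω' : ∀ t ∈ J, angularVelocity R t = R t *ᵥ Ω t := fun t ht => by
    rw [← hω t ht, mulVec_transpose_mulVec (hR t ht)]
  have hq : ∀ t ∈ J, HasDerivAt (fun t => B.a • (R t *ᵥ γ t))
      ((B.b * (1 + B.b / B.a)⁻¹) • (R t *ᵥ (Ω t ⨯₃ γ t))) t := fun t ht => by
    refine ((hasDerivAt_mulVec (fun i j => hRdiff i j t ht)
      (hγ t ht)).fun_const_smul B.a).congr_deriv ?_
    rw [hRd t ht, ← cross_anticomm (Ω t) (γ t), ← Matrix.mulVec_add, ← Matrix.mulVec_smul,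
      ← Matrix.mulVec_smul]
    congr 1
    have e : B.b * (1 + B.b / B.a)⁻¹ = B.a * (1 - (1 + B.b / B.a)⁻¹) := by
      field_simp
      ring
    rw [e]
    module
  refine ⟨?_, hRC, fun t ht => ?_, hR, fun t ht => ⟨?_, ?_⟩, fun t ht δq δθ hδ => ?_⟩
  · rw [contDiffOn_pi] at hγC ⊢
    intro i
    simp only [Pi.smul_apply, Matrix.mulVec, Matrix.vec3_dotProduct]
    exact (((hRC i 0).mul (hγC 0)).add ((hRC i 1).mul (hγC 1))).add ((hRC i 2).mul (hγC 2))
      |>.const_smul B.a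
  · rw [smul_dotProduct, dotProduct_smul, mulVec_dot_mulVec (hR t ht), hγ1 t ht]
    simp [sq]
  · rw [(hq t ht).deriv, hω' t ht, (crossProduct _).map_smul, mulVec_cross_mulVec (hR t ht),
      smul_smul, smul_smul]
    congr 1
    field_simp
  · rw [hω' t ht, dotProduct_smul, mulVec_dot_mulVec (hR t ht), hΩγ t ht, smul_zero]
  · have hrot := hR t ht
    set n := (R t)ᵀ *ᵥ δθ with hn
    have hδθ : δθ = R t *ᵥ n := by rw [hn, mulVec_transpose_mulVec hrot]
    obtain ⟨h1, h2⟩ := hδ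
    rw [hδθ, dotProduct_smul, mulVec_dot_mulVec hrot] at h2
    have hnγ : n ⬝ᵥ γ t = 0 := (smul_eq_zero.1 h2).resolve_left ha
    have hc : B.center δq = B.b • (R t *ᵥ (n ⨯₃ γ t)) := by
      rw [center, h1, hδθ, (crossProduct _).map_smul, mulVec_cross_mulVec hrot, smul_smul]
      congr 1
      field_simp
    have hℓ : deriv (B.angularMomentum R) t = R t *ᵥ (Ω t ⨯₃ (B.inertiaMatrix *ᵥ Ω t) +
        B.inertiaMatrix *ᵥ Ω' t) := by
      have h3 := hasDerivAt_mulVec (fun i j => hRdiff i j t ht)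
        (hasDerivAt_const_mulVec B.inertiaMatrix (hΩ t ht))
      rw [hRd t ht, ← Matrix.mulVec_add] at h3
      refine (h3.congr_of_eventuallyEq ?_).deriv
      filter_upwards [hJ.mem_nhds ht] with s hs
      rw [angularMomentum, hω s hs]
    have hq'' : deriv (deriv fun s => B.center (B.a • (R s *ᵥ γ s))) t = B.b •
        (R t *ᵥ (Ω t ⨯₃ (Ω t ⨯₃ γ t) + (Ω' t ⨯₃ γ t +
          Ω t ⨯₃ ((1 + B.b / B.a)⁻¹ • (γ t ⨯₃ Ω t))))) := by
      have h3 := (hasDerivAt_mulVec (fun i j => hRdiff i j t ht)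
        (hasDerivAt_cross (hΩ t ht) (hγ t ht))).fun_const_smul B.b
      rw [hRd t ht, ← Matrix.mulVec_add] at h3
      refine (h3.congr_of_eventuallyEq ?_).deriv
      filter_upwards [hJ.mem_nhds ht] with s hs
      refine ((hq s hs).fun_const_smul (1 + B.b / B.a)).deriv.trans ?_
      rw [smul_smul]
      congr 1
      field_simp
    have hpar : ∀ y : Fin 3 → ℝ, (Ω t ⨯₃ (Ω t ⨯₃ y)) = -(Ω t ⬝ᵥ Ω t) • y + (Ω t ⬝ᵥ y) • Ω t := by
      intro y
      rw [cross_cross_eq_smul_sub_smul']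
      module
    have hγn : γ t ⬝ᵥ (n ⨯₃ γ t) = 0 := dot_cross_self _ _
    have hacc : (Ω t ⨯₃ (Ω t ⨯₃ γ t) + (Ω' t ⨯₃ γ t +
          Ω t ⨯₃ ((1 + B.b / B.a)⁻¹ • (γ t ⨯₃ Ω t)))) ⬝ᵥ (n ⨯₃ γ t) = Ω' t ⬝ᵥ n := by
      rw [← cross_anticomm (Ω t) (γ t), (crossProduct _).map_smul, map_neg, hpar, hΩγ t ht]
      simp only [add_dotProduct, smul_dotProduct, neg_dotProduct, hγn, cross_dot_cross, zero_smul,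
        smul_zero, neg_zero, add_zero, zero_add, hγ1 t ht, dotProduct_comm (γ t) n, hnγ, mul_one,
        mul_zero, sub_zero]
    rw [hq'', hℓ, hc, hδθ, smul_dotProduct, dotProduct_smul, mulVec_dot_mulVec hrot,
      mulVec_dot_mulVec hrot, hacc, ← hbody t ht n hnγ]
    simp only [contactForm, inertiaMatrix, Matrix.mulVec_diagonal, Matrix.vec3_dotProduct,
      Fin.sum_univ_three, Pi.add_apply, smul_eq_mul]
    ring

/-- The states `(R, γ, Ω)` of the equations of motion in the body frame. -/
abbrev BodyState : Type := (Fin 3 → Fin 3 → ℝ) × (Fin 3 → ℝ) × (Fin 3 → ℝ)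

variable (B)

/-- The gyroscopic torque `(A Ω) × Ω`. -/
noncomputable def torque (x : BodyState) : Fin 3 → ℝ :=
  (B.inertiaMatrix *ᵥ x.2.2) ⨯₃ x.2.2

/-- The multiplier that keeps `Ω` orthogonal to `γ`. -/
noncomputable def multiplier (x : BodyState) : ℝ :=
  -(∑ j, B.torque x j * x.2.1 j / (B.inertia j + B.μ * B.b ^ 2)) /
    ∑ j, x.2.1 j ^ 2 / (B.inertia j + B.μ * B.b ^ 2)

/-- The equations of motion in the body frame,
`R' = R Ω^`, `(1 + b/a) γ' = γ × Ω`, `(A + μ b²) Ω' = A Ω × Ω + κ γ`. -/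
noncomputable def bodyField (x : BodyState) : BodyState :=
  (fun i => x.1 i ⨯₃ x.2.2, (1 + B.b / B.a)⁻¹ • (x.2.1 ⨯₃ x.2.2),
    fun j => (B.torque x j + B.multiplier x * x.2.1 j) / (B.inertia j + B.μ * B.b ^ 2))

theorem inertia_add_pos (j : Fin 3) : 0 < B.inertia j + B.μ * B.b ^ 2 := by
  have h7 := mul_nonneg B.mu_pos.le (sq_nonneg B.b)
  have h1 := B.inertia_pos
  have h2 := B.inertia_lt₁
  have h3 := B.inertia_lt₂
  fin_cases j <;> dsimp <;> linarith

theorem multiplier_den_pos {g : Fin 3 → ℝ} (hg : g ≠ 0) :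
    0 < ∑ j, g j ^ 2 / (B.inertia j + B.μ * B.b ^ 2) := by
  obtain ⟨j, hj⟩ := Function.ne_iff.1 hg
  refine Finset.sum_pos' (fun j _ => div_nonneg (sq_nonneg _) (B.inertia_add_pos j).le)
    ⟨j, Finset.mem_univ _, div_pos (sq_pos_of_ne_zero hj) (B.inertia_add_pos j)⟩

theorem contDiff_cross {E : Type*} [NormedAddCommGroup E] [NormedSpace ℝ E] {f g : E → Fin 3 → ℝ}
    {n : WithTop ℕ∞} (hf : ContDiff ℝ n f) (hg : ContDiff ℝ n g) :
    ContDiff ℝ n fun x => f x ⨯₃ g x := by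
  rw [contDiff_pi] at hf hg ⊢
  intro j
  fin_cases j <;> simp only [cross_apply] <;> dsimp
  exacts [((hf 1).mul (hg 2)).sub ((hf 2).mul (hg 1)),
    ((hf 2).mul (hg 0)).sub ((hf 0).mul (hg 2)), ((hf 0).mul (hg 1)).sub ((hf 1).mul (hg 0))]

theorem contDiff_torque : ContDiff ℝ 1 B.torque := by
  refine contDiff_cross ?_ (by fun_prop)
  rw [contDiff_pi]
  intro j
  simp only [inertiaMatrix, Matrix.mulVec_diagonal]
  fun_prop

theorem contDiffAt_bodyField {x : BodyState} (hx : x.2.1 ≠ 0) :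
    ContDiffAt ℝ 1 B.bodyField x := by
  have ht := fun j => (contDiff_pi.1 B.contDiff_torque j).contDiffAt (x := x)
  have hg : ∀ j, ContDiffAt ℝ 1 (fun y : BodyState => y.2.1 j) x := fun j => by fun_prop
  have hκ : ContDiffAt ℝ 1 B.multiplier x := by
    refine ContDiffAt.div ?_ ?_ (B.multiplier_den_pos hx).ne'
    · exact (ContDiffAt.sum fun j _ => ((ht j).mul (hg j)).div_const _).neg
    · exact ContDiffAt.sum fun j _ => ((hg j).pow 2).div_const _
  refine ContDiffAt.prodMk (contDiffAt_pi.2 fun i => ?_) (ContDiffAt.prodMk ?_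
    (contDiffAt_pi.2 fun j => ?_))
  · exact (contDiff_cross (by fun_prop) (by fun_prop)).contDiffAt
  · exact ((contDiff_cross (by fun_prop) (by fun_prop)).const_smul _).contDiffAt
  · exact ((ht j).add (hκ.mul (hg j))).div_const _

theorem eqOn_Ioo_of_hasDerivAt_zero {f : ℝ → ℝ} {δ : ℝ} (hδ : 0 < δ)
    (hf : ∀ t ∈ Set.Ioo (-δ) δ, HasDerivAt f 0 t) {t : ℝ} (ht : t ∈ Set.Ioo (-δ) δ) :
    f t = f 0 :=
  isOpen_Ioo.is_const_of_deriv_eq_zero isPreconnected_Ioo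
    (fun s hs => (hf s hs).differentiableAt.differentiableWithinAt) (fun s hs => (hf s hs).deriv)
    ht ⟨by linarith, hδ⟩

variable {B}

/-- First integrals of the equations of motion in the body frame: the rows of `R` remain a
positively oriented orthonormal frame, `γ` remains a unit vector and `Ω` remains orthogonal
to `γ`. -/
theorem bodyField_invariants {α : ℝ → BodyState} {δ : ℝ} (hδ : 0 < δ)
    (hα : ∀ t ∈ Set.Ioo (-δ) δ, HasDerivAt α (B.bodyField (α t)) t)
    (hR : Matrix.of (α 0).1 ∈ Matrix.specialOrthogonalGroup (Fin 3) ℝ)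
    (hγ : (α 0).2.1 ⬝ᵥ (α 0).2.1 = 1) (hΩ : (α 0).2.2 ⬝ᵥ (α 0).2.1 = 0) {t : ℝ}
    (ht : t ∈ Set.Ioo (-δ) δ) :
    Matrix.of (α t).1 ∈ Matrix.specialOrthogonalGroup (Fin 3) ℝ ∧
      (α t).2.1 ⬝ᵥ (α t).2.1 = 1 ∧ (α t).2.2 ⬝ᵥ (α t).2.1 = 0 := by
  have dR : ∀ s ∈ Set.Ioo (-δ) δ, ∀ i, HasDerivAt (fun s => (α s).1 i) ((α s).1 i ⨯₃ (α s).2.2) s :=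
    fun s hs i => hasDerivAt_pi.1 (hα s hs).fst i
  have dγ : ∀ s ∈ Set.Ioo (-δ) δ, HasDerivAt (fun s => (α s).2.1)
    ((1 + B.b / B.a)⁻¹ • ((α s).2.1 ⨯₃ (α s).2.2)) s := fun s hs => (hα s hs).snd.fst
  have dΩ : ∀ s ∈ Set.Ioo (-δ) δ, HasDerivAt (fun s => (α s).2.2) (B.bodyField (α s)).2.2 s :=
    fun s hs => (hα s hs).snd.snd
  have h1 : ∀ s ∈ Set.Ioo (-δ) δ, (α s).2.1 ⬝ᵥ (α s).2.1 = 1 := by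
    intro s hs
    rw [← hγ]
    refine eqOn_Ioo_of_hasDerivAt_zero (f := fun s => (α s).2.1 ⬝ᵥ (α s).2.1) hδ
      (fun r hr => (hasDerivAt_dotProduct (dγ r hr) (dγ r hr)).congr_deriv ?_) hs
    simp [dot_self_cross, dotProduct_comm _ (α r).2.1]
  refine ⟨?_, h1 t ht, ?_⟩
  · have hrow : ∀ i j, (α t).1 i ⬝ᵥ (α t).1 j = (α 0).1 i ⬝ᵥ (α 0).1 j := fun i j => by
      refine eqOn_Ioo_of_hasDerivAt_zero (f := fun s => (α s).1 i ⬝ᵥ (α s).1 j) hδ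
        (fun r hr => (hasDerivAt_dotProduct (dR r hr i) (dR r hr j)).congr_deriv ?_) ht
      simp only [cross_apply, Matrix.vec3_dotProduct, Matrix.cons_val]
      ring
    have hdet : (α t).1 0 ⬝ᵥ ((α t).1 1 ⨯₃ (α t).1 2) =
        (α 0).1 0 ⬝ᵥ ((α 0).1 1 ⨯₃ (α 0).1 2) := by
      refine eqOn_Ioo_of_hasDerivAt_zero (f := fun s => (α s).1 0 ⬝ᵥ ((α s).1 1 ⨯₃ (α s).1 2)) hδ
        (fun r hr => (hasDerivAt_dotProduct (dR r hr 0)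
          (hasDerivAt_cross (dR r hr 1) (dR r hr 2))).congr_deriv ?_) ht
      simp only [cross_apply, Matrix.vec3_dotProduct, Pi.add_apply, Matrix.cons_val]
      ring
    have hd : ∀ M : Fin 3 → Fin 3 → ℝ, (Matrix.of M).det = M 0 ⬝ᵥ (M 1 ⨯₃ M 2) := fun M => by
      rw [triple_product_eq_det]
      congr 1
      ext i j
      fin_cases i <;> rfl
    rw [Matrix.mem_specialOrthogonalGroup_iff, Matrix.mem_orthogonalGroup_iff] at hR ⊢
    refine ⟨?_, by rw [hd, hdet, ← hd, hR.2]⟩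
    rw [← hR.1]
    ext i j
    exact hrow i j
  · rw [← hΩ]
    refine eqOn_Ioo_of_hasDerivAt_zero (f := fun s => (α s).2.2 ⬝ᵥ (α s).2.1) hδ
      (fun r hr => (hasDerivAt_dotProduct (dΩ r hr) (dγ r hr)).congr_deriv ?_) ht
    have hne : (α r).2.1 ≠ 0 := fun h => by simpa [h] using h1 r hr
    rw [dotProduct_smul, dot_cross_self, smul_zero, add_zero]
    have h2 := (B.multiplier_den_pos hne).ne'
    have h3 : B.multiplier (α r) * ∑ j, (α r).2.1 j ^ 2 / (B.inertia j + B.μ * B.b ^ 2) =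
        -(∑ j, B.torque (α r) j * (α r).2.1 j / (B.inertia j + B.μ * B.b ^ 2)) :=
      div_mul_cancel₀ _ h2
    simp only [Fin.sum_univ_three] at h3
    simp only [bodyField, Matrix.vec3_dotProduct]
    linear_combination h3

theorem contDiffOn_succ_of_hasDerivAt {E : Type*} [NormedAddCommGroup E] [NormedSpace ℝ E]
    {f f' : ℝ → E} {J : Set ℝ} (hJ : IsOpen J) {n : ℕ} (hf : ∀ t ∈ J, HasDerivAt f (f' t) t)
    (hf' : ContDiffOn ℝ n f' J) : ContDiffOn ℝ (n + 1) f J := by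
  rw [contDiffOn_succ_iff_deriv_of_isOpen hJ]
  exact ⟨fun t ht => (hf t ht).differentiableAt.differentiableWithinAt, by simp,
    hf'.congr fun t ht => (hf t ht).deriv⟩

theorem contDiffOn_cross {f g : ℝ → Fin 3 → ℝ} {J : Set ℝ}
    {n : WithTop ℕ∞} (hf : ContDiffOn ℝ n f J) (hg : ContDiffOn ℝ n g J) :
    ContDiffOn ℝ n (fun x => f x ⨯₃ g x) J :=
  (contDiff_cross (f := fun x : (Fin 3 → ℝ) × (Fin 3 → ℝ) => x.1) (by fun_prop)
    (contDiff_snd)).comp_contDiffOn (hf.prodMk hg)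

/-- Integral curves of the equations in the body frame are motions of the ball. -/
theorem isRollingMotion_of_bodyField {α : ℝ → BodyState} {δ : ℝ} (hδ : 0 < δ)
    (hα : ∀ t ∈ Set.Ioo (-δ) δ, HasDerivAt α (B.bodyField (α t)) t)
    (hR : Matrix.of (α 0).1 ∈ Matrix.specialOrthogonalGroup (Fin 3) ℝ)
    (hγ : (α 0).2.1 ⬝ᵥ (α 0).2.1 = 1) (hΩ : (α 0).2.2 ⬝ᵥ (α 0).2.1 = 0) :
    B.IsRollingMotion (fun t => B.a • (Matrix.of (α t).1 *ᵥ (α t).2.1))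
      (fun t => Matrix.of (α t).1) (Set.Ioo (-δ) δ) := by
  have hinv := fun t (ht : t ∈ Set.Ioo (-δ) δ) => bodyField_invariants hδ hα hR hγ hΩ ht
  have hne : ∀ t ∈ Set.Ioo (-δ) δ, (α t).2.1 ≠ 0 := fun t ht h => by
    simpa [h] using (hinv t ht).2.1
  have hα1 : ContDiffOn ℝ 1 α (Set.Ioo (-δ) δ) := by
    refine contDiffOn_succ_of_hasDerivAt (n := 0) isOpen_Ioo hα ?_
    rw [Nat.cast_zero, contDiffOn_zero]
    exact fun t ht => ((B.contDiffAt_bodyField (hne t ht)).continuousAt.comp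
      (hα t ht).continuousAt).continuousWithinAt
  have cR : ∀ i, ContDiffOn ℝ 1 (fun t => (α t).1 i) (Set.Ioo (-δ) δ) :=
    contDiffOn_pi.1 hα1.fst
  have cγ : ContDiffOn ℝ 1 (fun t => (α t).2.1) (Set.Ioo (-δ) δ) := hα1.snd.fst
  have cΩ : ContDiffOn ℝ 1 (fun t => (α t).2.2) (Set.Ioo (-δ) δ) := hα1.snd.snd
  have dR : ∀ t ∈ Set.Ioo (-δ) δ, ∀ i,
      HasDerivAt (fun s => (α s).1 i) ((α t).1 i ⨯₃ (α t).2.2) t :=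
    fun t ht i => hasDerivAt_pi.1 (hα t ht).fst i
  have two : ((1 : ℕ) : WithTop ℕ∞) + 1 = 2 := by norm_num
  refine isRollingMotion_of_body_equation (γ := fun t => (α t).2.1) (Ω := fun t => (α t).2.2)
    (Ω' := fun t => (B.bodyField (α t)).2.2) isOpen_Ioo (fun t ht => (hinv t ht).1) ?_ ?_ ?_
    (fun t ht => (hα t ht).snd.fst) (fun t ht => (hα t ht).snd.snd) (fun t ht => (hinv t ht).2.1)
    (fun t ht => (hinv t ht).2.2) ?_
  · intro i
    refine (contDiffOn_pi (Φ := fun t => (α t).1 i)).1 ?_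
    rw [← two]
    exact contDiffOn_succ_of_hasDerivAt isOpen_Ioo (fun t ht => dR t ht i)
      (by exact_mod_cast contDiffOn_cross (cR i) cΩ)
  · rw [← two]
    exact contDiffOn_succ_of_hasDerivAt isOpen_Ioo (fun t ht => (hα t ht).snd.fst)
      (by exact_mod_cast (contDiffOn_cross cγ cΩ).const_smul _)
  · intro t ht x
    have hM : matrixDeriv (fun t => Matrix.of (α t).1) t =
        Matrix.of fun i => (α t).1 i ⨯₃ (α t).2.2 := by
      ext i j
      exact (hasDerivAt_pi.1 (dR t ht i) j).deriv
    rw [hM]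
    ext i
    simp only [Matrix.mulVec, Matrix.of_apply, cross_apply, Matrix.vec3_dotProduct, Matrix.cons_val]
    ring
  · intro t ht n hn
    have hj := fun j => (B.inertia_add_pos j).ne'
    have h0 := hj 0
    have h1 := hj 1
    have h2 := hj 2
    rw [← cross_anticomm, neg_dotProduct]
    change _ + -(B.torque (α t) ⬝ᵥ n) = 0
    rw [Matrix.vec3_dotProduct] at hn
    simp only [contactForm, bodyField, Fin.sum_univ_three, Matrix.vec3_dotProduct,
      mul_div_cancel₀ _ h0, mul_div_cancel₀ _ h1, mul_div_cancel₀ _ h2]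
    linear_combination B.multiplier (α t) * hn

/-- From every reduced state and every attitude there starts a motion. -/
theorem exists_isReducedMotion {ε : Fin 3 → ℝ} (hε : ∀ j, ε j = 1 ∨ ε j = -1) (z₀ : Phase)
    (R₀ : Matrix (Fin 3) (Fin 3) ℝ) (hz₀ : z₀.1 ∈ B.coordDomain)
    (hR₀ : R₀ ∈ Matrix.specialOrthogonalGroup (Fin 3) ℝ) :
    ∃ (δ : ℝ) (q : ℝ → Fin 3 → ℝ) (R : ℝ → Matrix (Fin 3) (Fin 3) ℝ) (z : ℝ → Phase), 0 < δ ∧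
      B.IsReducedMotion ε q R z (Set.Ioo (-δ) δ) ∧ z 0 = z₀ ∧ R 0 = R₀ := by
  have hbij := B.gammaOf_bijOn hε
  obtain ⟨v₀, hv₀, hP₀⟩ := (B.momenta_bijOn hε hz₀).surjOn (Set.mem_univ z₀.2)
  have hg1 := B.gammaOf_dot_self hε hz₀
  have hk := B.ratio_ne_zero
  set g₀ := B.gammaOf ε z₀.1 with hg₀
  have hv₀' : v₀ ⬝ᵥ g₀ = 0 := hv₀
  have hgne : g₀ ≠ 0 := fun h => by simp [h] at hg1
  obtain ⟨α, hα0, δ₁, hδ₁, hα⟩ :=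
    (B.contDiffAt_bodyField (x := (fun i j => R₀ i j, g₀, (1 + B.b / B.a) • (v₀ ⨯₃ g₀)))
      hgne).exists_forall_mem_closedBall_exists_eq_forall_mem_Ioo_hasDerivAt₀ 0
  rw [zero_sub, zero_add] at hα
  -- the solution stays in the octant for a short time
  have hoct : ∀ᶠ t in nhds (0 : ℝ), ∀ j, 0 < ε j * (α t).2.1 j := by
    rw [Filter.eventually_all]
    intro j
    have hc : ContinuousAt (fun t => ε j * (α t).2.1 j) 0 :=
      ((hasDerivAt_pi.1 (hα 0 ⟨by linarith, hδ₁⟩).snd.fst j).continuousAt).const_mul _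
    refine hc.eventually (lt_mem_nhds ?_)
    dsimp only
    rw [hα0]
    exact (hbij.mapsTo hz₀).2 j
  obtain ⟨δ₂, hδ₂, hball⟩ := Metric.eventually_nhds_iff.1 hoct
  set δ := min δ₁ δ₂
  have hδ : 0 < δ := lt_min hδ₁ hδ₂
  have hα' : ∀ t ∈ Set.Ioo (-δ) δ, HasDerivAt α (B.bodyField (α t)) t := fun t ht =>
    hα t ⟨by linarith [ht.1, min_le_left δ₁ δ₂], by linarith [ht.2, min_le_left δ₁ δ₂]⟩
  have hR0 : Matrix.of (α 0).1 ∈ Matrix.specialOrthogonalGroup (Fin 3) ℝ := by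
    rw [hα0]; exact hR₀
  have hγ0 : (α 0).2.1 ⬝ᵥ (α 0).2.1 = 1 := by rw [hα0]; exact hg1
  have hΩ0 : (α 0).2.2 ⬝ᵥ (α 0).2.1 = 0 := by
    rw [hα0, smul_dotProduct, dotProduct_comm, dot_cross_self, smul_zero]
  have hinv := fun t (ht : t ∈ Set.Ioo (-δ) δ) => bodyField_invariants hδ hα' hR0 hγ0 hΩ0 ht
  set R : ℝ → Matrix (Fin 3) (Fin 3) ℝ := fun t => Matrix.of (α t).1 with hR
  set q : ℝ → Fin 3 → ℝ := fun t => B.a • (R t *ᵥ (α t).2.1) with hq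
  have hpo : ∀ t ∈ Set.Ioo (-δ) δ, B.poisson q R t = (α t).2.1 := fun t ht => by
    rw [poisson, hq, inv_smul_smul₀ B.a_pos.ne', transpose_mulVec_mulVec (hinv t ht).1]
  have hmem : ∀ t ∈ Set.Ioo (-δ) δ, (α t).2.1 ∈ octant ε := fun t ht => by
    refine ⟨(hinv t ht).2.1, hball ?_⟩
    rw [Real.dist_0_eq_abs, abs_lt]
    exact ⟨by linarith [ht.1, min_le_right δ₁ δ₂], by linarith [ht.2, min_le_right δ₁ δ₂]⟩
  set L : ℝ → Fin 2 → ℝ := fun t => Function.invFunOn (B.gammaOf ε) B.coordDomain (α t).2.1 with hL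
  have h0 : (0 : ℝ) ∈ Set.Ioo (-δ) δ := ⟨by linarith, hδ⟩
  have hL0 : L 0 = z₀.1 := by
    rw [hL]
    dsimp only
    rw [hα0]
    exact hbij.injOn.leftInvOn_invFunOn hz₀
  refine ⟨δ, q, R, fun t => (L t, B.momenta ε (L t) (deriv (B.poisson q R) t)), hδ,
    ⟨isRollingMotion_of_bodyField hδ hα' hR0 hγ0 hΩ0, fun t ht => ⟨?_, ?_, rfl⟩⟩, ?_, ?_⟩
  · exact Function.invFunOn_mem (hbij.surjOn (hmem t ht))
  · rw [hpo t ht]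
    exact Function.invFunOn_eq (hbij.surjOn (hmem t ht))
  · have hd : deriv (B.poisson q R) 0 = v₀ := by
      have h1 : HasDerivAt (fun t => (α t).2.1) (B.bodyField (α 0)).2.1 0 := (hα' 0 h0).snd.fst
      refine (h1.congr_of_eventuallyEq ?_).deriv.trans ?_
      · filter_upwards [isOpen_Ioo.mem_nhds h0] with s hs
        exact hpo s hs
      · rw [hα0]
        simp only [bodyField]
        rw [(crossProduct _).map_smul, inv_smul_smul₀ hk, cross_cross_eq_smul_sub_smul', hg1,
          hv₀']
        simp
    refine Prod.ext hL0 ?_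
    dsimp only
    rw [hL0, hd, hP₀]
  · ext i j
    simp only [hR, hα0]
    rfl

/-! ### Change of time -/

variable (B) in
theorem continuous_F : Continuous B.F := by
  unfold F
  fun_prop

/-- If `τ` is a new time with `τ' = f > 0` on an interval, then a curve with velocity `f t • X t`
has velocity `X t` with respect to `τ`. -/
theorem exists_reparametrization {E : Type*} [NormedAddCommGroup E] [NormedSpace ℝ E]
    {J : Set ℝ} (hJ : IsOpen J) (hJc : J.OrdConnected) {τ f : ℝ → ℝ} {z X : ℝ → E}
    (hf : ContinuousOn f J) (hpos : ∀ t ∈ J, 0 < f t) (hτ : ∀ t ∈ J, HasDerivAt τ (f t) t)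
    (hz : ∀ t ∈ J, HasDerivAt z (f t • X t) t) :
    ∃ w : ℝ → E, ∀ t ∈ J, w (τ t) = z t ∧ HasDerivAt w (X t) (τ t) := by
  have hmono : StrictMonoOn τ J := by
    refine strictMonoOn_of_deriv_pos hJc.convex
      (fun t ht => (hτ t ht).continuousAt.continuousWithinAt) fun t ht => ?_
    have ht' := interior_subset ht
    rw [(hτ t ht').deriv]
    exact hpos t ht'
  have hinv : ∀ t ∈ J, Function.invFunOn τ J (τ t) = t := fun t ht =>
    hmono.injOn.leftInvOn_invFunOn ht
  refine ⟨z ∘ Function.invFunOn τ J, fun t ht => ⟨by simp [hinv t ht], ?_⟩⟩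
  have hs : HasStrictDerivAt τ (f t) t := hasStrictDerivAt_of_hasDerivAt_of_continuousAt
    (by filter_upwards [hJ.mem_nhds ht] with s hs using hτ s hs)
    (hf.continuousAt (hJ.mem_nhds ht))
  have hi := (hs.to_local_left_inverse (hpos t ht).ne' (g := Function.invFunOn τ J)
    (by filter_upwards [hJ.mem_nhds ht] with s hs using hinv s hs)).hasDerivAt
  have hz' := hz t ht
  rw [← hinv t ht] at hz'
  refine (hz'.scomp (τ t) hi).congr_deriv ?_
  rw [hinv t ht, inv_smul_smul₀ (hpos t ht).ne']

theorem exists_primitive {J : Set ℝ} (hJ : IsOpen J) (hJc : J.OrdConnected) {f : ℝ → ℝ}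
    (hf : ContinuousOn f J) : ∃ τ : ℝ → ℝ, ∀ t ∈ J, HasDerivAt τ (f t) t := by
  rcases J.eq_empty_or_nonempty with rfl | ⟨t₀, ht₀⟩
  · exact ⟨0, fun t ht => ht.elim⟩
  · exact ⟨fun u => ∫ x in t₀..u, f x, fun t ht => intervalIntegral.integral_hasDerivAt_right
      (hf.mono (hJc.uIcc_subset ht₀ ht)).intervalIntegrable
      (hf.stronglyMeasurableAtFilter hJ t ht) (hf.continuousAt (hJ.mem_nhds ht))⟩

end RubberBall

theorem theorem1 (B : RubberBall) (ε : Fin 3 → ℝ) (hε : ∀ j, ε j = 1 ∨ ε j = -1) :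
    -- sphero-conical coordinates on the octant, and the coordinates `(λ, P)` over it
    Set.BijOn (B.gammaOf ε) B.coordDomain (RubberBall.octant ε) ∧
    (∀ l ∈ B.coordDomain,
      Set.BijOn (B.momenta ε l) {v | v ⬝ᵥ B.gammaOf ε l = 0} Set.univ) ∧
    -- the function `F` in these coordinates
    (∀ l ∈ B.coordDomain, B.F (B.gammaOf ε l) =
      (1 + B.b / B.a) ^ 2 * (l 0 + B.μ * B.b ^ 2) * (l 1 + B.μ * B.b ^ 2)) ∧
    -- the reduced nonholonomic vector field is `F ^ ((b - a)/(2a))` times `X_H`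
    (∀ X : RubberBall.Phase → RubberBall.Phase, B.IsNonholonomicField ε X ↔
      ∀ z : RubberBall.Phase, z.1 ∈ B.coordDomain →
        X z = B.F (B.gammaOf ε z.1) ^ ((B.b - B.a) / (2 * B.a)) •
          RubberBall.canonicalField B.hamiltonian z) ∧
    -- in the new time `τ`, every motion solves Hamilton's equations
    (∀ (J : Set ℝ) (q : ℝ → Fin 3 → ℝ) (R : ℝ → Matrix (Fin 3) (Fin 3) ℝ)
        (z : ℝ → RubberBall.Phase), IsOpen J → J.OrdConnected → B.IsReducedMotion ε q R z J →
      (∃ τ : ℝ → ℝ, ∀ t ∈ J,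
        HasDerivAt τ (B.F (B.poisson q R t) ^ ((B.b - B.a) / (2 * B.a))) t) ∧
      ∀ τ : ℝ → ℝ, (∀ t ∈ J,
          HasDerivAt τ (B.F (B.poisson q R t) ^ ((B.b - B.a) / (2 * B.a))) t) →
        ∃ w : ℝ → RubberBall.Phase, ∀ t ∈ J, w (τ t) = z t ∧
          HasDerivAt w (RubberBall.canonicalField B.hamiltonian (w (τ t))) (τ t)) := by
  refine ⟨B.gammaOf_bijOn hε, fun l hl => B.momenta_bijOn hε hl, fun l hl => B.F_gammaOf hε hl,
    fun X => ⟨fun hX z₀ hz₀ => ?_, fun hX => ⟨fun J q R z hJ _ hz t ht => ?_,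
      fun z₀ R₀ hz₀ hR₀ => RubberBall.exists_isReducedMotion hε z₀ R₀ hz₀ hR₀⟩⟩,
    fun J q R z hJ hJc hz => ?_⟩
  · -- Through every reduced state there passes the projection of a motion, whose velocity is unique.
    obtain ⟨δ, q, R, z, hδ, hz, h0, -⟩ :=
      RubberBall.exists_isReducedMotion hε z₀ 1 hz₀ (one_mem _)
    have hmem : (0 : ℝ) ∈ Set.Ioo (-δ) δ := ⟨by linarith, hδ⟩
    rw [← h0]
    exact (hX.1 _ q R z isOpen_Ioo Set.ordConnected_Ioo hz 0 hmem).unique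
      (hz.hasDerivAt hε isOpen_Ioo hmem)
  · rw [hX _ (hz.2 t ht).1]
    exact hz.hasDerivAt hε hJ ht
  · have hFpos : ∀ t ∈ J, 0 < B.F (B.poisson q R t) ^ ((B.b - B.a) / (2 * B.a)) := fun t ht => by
      rw [← (hz.2 t ht).2.1, B.F_rpow hε (hz.2 t ht).1]
      exact mul_pos (inv_pos.2 B.scale_pos) (B.prodShift_rpow_pos (hz.2 t ht).1 _)
    have hFc : ContinuousOn (fun t => B.F (B.poisson q R t) ^ ((B.b - B.a) / (2 * B.a))) J := by
      refine ContinuousOn.rpow_const (B.continuous_F.comp_continuousOn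
        hz.1.contDiffOn_poisson.continuousOn) fun t ht => Or.inl ?_
      have hk := B.ratio_ne_zero
      have h0 := B.shift_pos (hz.2 t ht).1 0
      have h1 := B.shift_pos (hz.2 t ht).1 1
      rw [← (hz.2 t ht).2.1, B.F_gammaOf hε (hz.2 t ht).1]
      positivity
    refine ⟨RubberBall.exists_primitive hJ hJc hFc, fun τ hτ => ?_⟩
    obtain ⟨w, hw⟩ := RubberBall.exists_reparametrization hJ hJc
      (X := fun t => RubberBall.canonicalField B.hamiltonian (z t)) hFc hFpos hτ fun t ht => by
        have h := hz.hasDerivAt hε hJ ht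
        rwa [(hz.2 t ht).2.1] at h
    exact ⟨w, fun t ht => ⟨(hw t ht).1, by rw [(hw t ht).1]; exact (hw t ht).2⟩⟩
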